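/- **Setting.** Let $I\ge 1$, $J_1,\dots,J_I\ge 1$, and consider cells $C_{ij}$ ($1\le i\le I$, $1\le j\le J_i$). For each $i$ let the $i$-th second-stage model be a regular parametric model of dimension $s_i\ge 0$ for the probabilities of $J_i$ cells: an open set $\Theta_i\subset\mathbb R^{s_i}$ and a $C^\infty$ map $\theta^{(i)}\mapsto p_i(\theta^{(i)})=(p_{i1},\dots,p_{iJ_i})$ from $\Theta_i$ to the vectors of positive probabilities with sum $1$, which is an embedding (injective differential everywhere, homeomorphism onto its image). The model is *full* if its image consists of all vectors of positive probabilities with sum $1$. Let $m_{i\cdot}>0$ be known first-stage probabilities with $\sum_i m_{i\cdot}=1$ (the first-stage model is full, and its parameters are known). The two-stage model consists of all $m=(m_{ij})$ with $m_{ij}=m_{i\cdot}\,p_{ij}(\theta^{(i)})$, $\theta^{(i)}\in\Theta_i$. Fix a true parameter, write $p_i$ and $m$ for the corresponding true probability vectors, and put $p'=I-1+\sum_i s_i$. A maximum likelihood estimator (MLE) assigns to each sample a maximizer of the multinomial likelihood over the closure of the model (so boundary estimates, such as relative frequencies with an empty cell, are allowed). For probability vectors let $D[q:r]=\sum_a q_a\log(q_a/r_a)$,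 with $0\log 0=0$. Let $ED_{(i)}(n)=E\bigl[D[\widehat p_i:p_i]\bigr]$, where $\widehat p_i$ is an MLE in the $i$-th second-stage model based on a multinomial sample of size $n$ with cell probabilities $p_i$. Let $ED(n)=E\bigl[D[\widehat m:m]\bigm| X_{i\cdot}\neq 0 \text{ for all } i\bigr]$, where $\widehat m$ is an MLE in the two-stage model based on a multinomial sample $(X_{ij})$ of size $n$ with cell probabilities $m$, and $X_{i\cdot}=\sum_j X_{ij}$. **Theorem.** There are real numbers $A_{(1)},\dots,A_{(I)}$ such that, as $n\to\infty$, for every $i$ and every MLE $\widehat p_i$, $$ED_{(i)}(n)=\frac{s_i}{2n}+\frac{A_{(i)}}{24n^2}+o(n^{-2})$$ (so that $A_{(i)}/(24n^2)$ is the second-order term of the $i$-th second-stage risk), and for every MLE $\widehat m$, $$ED(n)=\frac1{2n}\sum_{i=1}^I s_i+\frac1{24n^2}\sum_{i=1}^I m_{i\cdot}^{-1}\bigl(A_{(i)}+12(1-m_{i\cdot})s_i\bigr)+o(n^{-2}).$$ If, moreover, every second-stage model is full, then the two-stage model is the non-overlapping $m$-aggregation submodel, consisting of all $(\mu_{ij})$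 with $\mu_{ij}>0$ and $\sum_{j}\mu_{ij}=m_{i\cdot}$ for every $i$, and for every MLE $\widehat m$ in it $$ED(n)=\frac{p'-(I-1)}{2n}+\frac1{12n^2}\Bigl(\sum_{i=1}^I\sum_{j=1}^{J_i}m_{ij}^{-1}+\sum_{i=1}^I m_{i\cdot}^{-1}(6J_i-7)-6(p'+1-I)\Bigr)+o(n^{-2}).$$ -/

import Mathlib

open Finset Filter Asymptotics
open scoped ContDiff Topology

noncomputable section

namespace TwoStage

/-- The multinomial probability of the vector of counts `x` when the cell probabilities are `q`
and the sample size is `∑ a, x a`. As a function of `q` it is the likelihood of the data `x`. -/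
def multinomialProb {α : Type*} [Fintype α] (q : α → ℝ) (x : α → ℕ) : ℝ :=
  (Nat.multinomial univ x : ℝ) * ∏ a, q a ^ x a

/-- `E[f(X)]` for `X` multinomial with sample size `n` and cell probabilities `q`;
`piAntidiag univ n` is the finite set of all vectors of counts with total `n`. -/
def expect {α : Type*} [Fintype α] [DecidableEq α] (q : α → ℝ) (n : ℕ)
    (f : (α → ℕ) → ℝ) : ℝ :=
  ∑ x ∈ piAntidiag univ n, multinomialProb q x * f x

/-- `E[f(X) | X ∈ S]` for `X` multinomial with sample size `n` and cell probabilities `q`. -/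
def condExpect {α : Type*} [Fintype α] [DecidableEq α] (q : α → ℝ) (n : ℕ)
    (S : Set (α → ℕ)) (f : (α → ℕ) → ℝ) : ℝ :=
  expect q n (S.indicator f) / expect q n (S.indicator fun _ => 1)

/-- Kullback--Leibler divergence `∑ r log (r / q)` of probability vectors, with `0 log 0 = 0`. -/
def klDivergence {α : Type*} [Fintype α] (r q : α → ℝ) : ℝ :=
  ∑ a, r a * Real.log (r a / q a)

/-- `est` is a maximum likelihood estimator for the set `M` of cell probability vectors, on the
set `S` of samples on which estimation is carried out. The estimate may lie on the boundary of
the model (as relative frequencies with an empty cell do), so that an estimator always exists;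
a maximizer inside `M` is a special case. -/
def IsMLE {α : Type*} [Fintype α] (M : Set (α → ℝ)) (S : Set (α → ℕ))
    (est : (α → ℕ) → α → ℝ) : Prop :=
  ∀ x ∈ S, est x ∈ closure M ∧ ∀ q ∈ M, multinomialProb q x ≤ multinomialProb (est x) x

/-- A regular `s`-dimensional parametric model for the probabilities of `J` cells: a smooth
embedding of an open subset of `ℝ^s` into the open probability simplex. -/
structure ParametricModel (J s : ℕ) where
  /-- the parameter space -/
  Θ : Set (Fin s → ℝ)
  /-- the cell probabilities as functions of the parameter -/
  prob : (Fin s → ℝ) → Fin J → ℝ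
  isOpen_Θ : IsOpen Θ
  prob_pos : ∀ θ ∈ Θ, ∀ j, 0 < prob θ j
  prob_sum : ∀ θ ∈ Θ, ∑ j, prob θ j = 1
  smooth : ContDiffOn ℝ ∞ prob Θ
  immersion : ∀ θ ∈ Θ, Function.Injective (fderiv ℝ prob θ)
  embedding : Topology.IsEmbedding (Θ.domRestrict prob)

/-- The set of cell probability vectors that belong to the model. -/
def ParametricModel.carrier {J s : ℕ} (M : ParametricModel J s) : Set (Fin J → ℝ) :=
  M.prob '' M.Θ

/-- The model is full: it contains every vector of positive probabilities. -/
def ParametricModel.IsFull {J s : ℕ} (M : ParametricModel J s) : Prop :=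
  M.carrier = {q | (∀ j, 0 < q j) ∧ ∑ j, q j = 1}

/-- The cells `C_{ij}` of a two-stage model, `j` running over the `J i` cells of group `i`. -/
abbrev Cell {I : ℕ} (J : Fin I → ℕ) : Type := (i : Fin I) × Fin (J i)

/-- The cell probabilities `m_{ij} = c_i p_{ij}`. -/
def cellProb {I : ℕ} {J : Fin I → ℕ} (c : Fin I → ℝ) (p : (i : Fin I) → Fin (J i) → ℝ) :
    Cell J → ℝ :=
  fun a => c a.1 * p a.1 a.2

/-- The two-stage model whose first-stage probabilities `c_i` are known and whose second-stage
models are the `M i`, parametrized independently of one another. -/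
def twoStageModel {I : ℕ} {J s : Fin I → ℕ} (c : Fin I → ℝ)
    (M : (i : Fin I) → ParametricModel (J i) (s i)) : Set (Cell J → ℝ) :=
  {m | ∃ θ : (i : Fin I) → Fin (s i) → ℝ,
    (∀ i, θ i ∈ (M i).Θ) ∧ m = cellProb c fun i => (M i).prob (θ i)}

/-- The non-overlapping `m`-aggregation submodel with the restrictions `∑ j, m_{ij} = c_i`. -/
def aggregationSubmodel {I : ℕ} (J : Fin I → ℕ) (c : Fin I → ℝ) : Set (Cell J → ℝ) :=
  {m | (∀ a, 0 < m a) ∧ ∀ i, ∑ j, m ⟨i, j⟩ = c i}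

/-- The samples in which no group is empty: `X_{i·} ≠ 0` for all `i`. -/
def noEmptyGroup {I : ℕ} (J : Fin I → ℕ) : Set (Cell J → ℕ) :=
  {x | ∀ i, ∑ j, x ⟨i, j⟩ ≠ 0}

/-- `R n = a / n + b / n² + o(n⁻²)`. -/
def HasExpansion (R : ℕ → ℝ) (a b : ℝ) : Prop :=
  (fun n : ℕ => R n - (a / n + b / (n : ℝ) ^ 2)) =o[atTop] fun n : ℕ => ((n : ℝ) ^ 2)⁻¹

end TwoStage

end

/-! Why one second-stage risk has an expansion. When the relative frequencies f are close to p, the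
estimate is a smooth function of f. It solves the likelihood equation, whose parameter derivative at
the truth is minus the Fisher information and hence invertible. The Hellinger bound
`sum_sq_sqrt_sub_sqrt_le` brings every maximizer over the closure into the range of the implicit
function theorem (`exists_smooth_estimate`). So the loss is a polynomial of degree four in f - p up
to C‖f - p‖⁵; where f is far from p, both are bounded and the fifth power absorbs the difference
(`exists_polynomial_approx`). Multinomial moments up to order four are explicit, and the fifth
absolute moments are o(n⁻²). The coefficient of 1/n is half the trace of the Fisher-orthogonal
projection onto the tangent space, which is s/2 (`sum_sq_fisher_projection`). The coefficient of
1/n² comes from the polynomial alone, so all estimators share it: `exists_envelope` squeezes them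
between the same two functions of the data.

Why the stages combine. The groups have independent parameters and the first stage is known, so the
likelihood factors, estimation is done group by group (`IsMaxLik.group`), and the divergence is the
c-weighted sum of the group divergences (`klDivergence_cellProb`). Given its size N, a group is a
multinomial sample from its own model, and N is binomial (`expect_groupCounts`). A risk a/N + b/N²
averages to a/(cn) + (a(1-c) + b)/(cn)² (`HasExpansion.binomialExpect`); the term a(1-c) is the
excess of E[1/N] over 1/(cn), and with a = s/2 it produces 12(1-c)s. Empty groups have exponentially
small probability, so the conditioning is invisible at this order.

In a full model the relative frequencies are an MLE, and their risk is computed by hand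
(`hasExpansion_klDivergence_relFreq`). Uniqueness of expansion coefficients then yields s = J - 1
and A = 2(∑ 1/p - 1). -/

noncomputable section

namespace TwoStage

/-! ### Multinomial expectations and moments of centred linear forms -/

section Expect

variable {α : Type*}

/-- The linear functional on the monoid algebra of count vectors that sends the monomial `x`
to `f x`. -/
def evalFunctional (f : (α → ℕ) → ℝ) : AddMonoidAlgebra ℝ (α → ℕ) →ₗ[ℝ] ℝ where
  toFun P := P.coeff.sum fun x r => r * f x
  map_add' P Q := by
    rw [AddMonoidAlgebra.coeff_add]
    exact Finsupp.sum_add_index' (by simp) (fun _ _ _ => by ring)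
  map_smul' r P := by
    rw [AddMonoidAlgebra.coeff_smul, Finsupp.sum_smul_index (by simp)]
    simp [Finsupp.sum, Finset.mul_sum, mul_assoc]

theorem evalFunctional_single (f : (α → ℕ) → ℝ) (x : α → ℕ) (r : ℝ) :
    evalFunctional f (AddMonoidAlgebra.single x r) = r * f x := by
  simp [evalFunctional]

variable [Fintype α] {q : α → ℝ}

theorem multinomialProb_nonneg (hq : ∀ a, 0 ≤ q a) (x : α → ℕ) : 0 ≤ multinomialProb q x :=
  mul_nonneg (Nat.cast_nonneg _) (Finset.prod_nonneg fun a _ => pow_nonneg (hq a) _)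

/-- The linear form `∑ a, x a * u a` of the counts. -/
def linForm (u : α → ℝ) (x : α → ℕ) : ℝ := ∑ a, (x a : ℝ) * u a

theorem linForm_zero (u : α → ℝ) : linForm u 0 = 0 := by simp [linForm]

variable [DecidableEq α] {n : ℕ}

theorem expect_zero_size (f : (α → ℕ) → ℝ) : expect q 0 f = f 0 := by
  simp [expect, multinomialProb, Nat.multinomial]

/-- The multinomial theorem in the monoid algebra of count vectors: the law of the counts is the
n-th power of the law of a single trial. -/
theorem expect_eq_evalFunctional (f : (α → ℕ) → ℝ) :
    expect q n f = evalFunctional f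
      ((∑ a, AddMonoidAlgebra.single (Pi.single a 1 : α → ℕ) (q a)) ^ n) := by
  rw [Finset.sum_pow_eq_sum_piAntidiag, map_sum]
  refine Finset.sum_congr rfl fun x _ => ?_
  have h : (∏ a, (AddMonoidAlgebra.single (Pi.single a 1 : α → ℕ) (q a)) ^ x a) =
      AddMonoidAlgebra.single x (∏ a, q a ^ x a) := by
    simp only [AddMonoidAlgebra.single_pow]
    rw [AddMonoidAlgebra.prod_single]
    congr 1
    ext b
    simp [Finset.sum_apply, Pi.single_apply]
  rw [h, ← nsmul_eq_mul, map_nsmul, evalFunctional_single, nsmul_eq_mul, multinomialProb, mul_assoc]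

/-- Splitting one factor off the n-th power conditions on a single trial. All moment formulas below
are inductions on this recursion. -/
theorem expect_succ (f : (α → ℕ) → ℝ) :
    expect q (n + 1) f = ∑ a, q a * expect q n fun x => f (x + Pi.single a 1) := by
  simp only [expect_eq_evalFunctional]
  rw [pow_succ, Finset.mul_sum, map_sum]
  refine Finset.sum_congr rfl fun a _ => ?_
  generalize (∑ a, AddMonoidAlgebra.single (Pi.single a 1 : α → ℕ) (q a)) ^ n = P
  induction P using AddMonoidAlgebra.induction_linear with
  | zero => simp
  | add P Q hP hQ => rw [add_mul, map_add, map_add, hP, hQ, mul_add]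
  | single x r =>
    rw [AddMonoidAlgebra.single_mul_single, evalFunctional_single, evalFunctional_single]
    ring

theorem expect_add (f g : (α → ℕ) → ℝ) :
    expect q n (fun x => f x + g x) = expect q n f + expect q n g := by
  simp only [expect, mul_add, Finset.sum_add_distrib]

theorem expect_sub (f g : (α → ℕ) → ℝ) :
    expect q n (fun x => f x - g x) = expect q n f - expect q n g := by
  simp only [expect, mul_sub, Finset.sum_sub_distrib]

theorem expect_const_mul (r : ℝ) (f : (α → ℕ) → ℝ) :
    expect q n (fun x => r * f x) = r * expect q n f := by
  simp only [expect, Finset.mul_sum]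
  exact Finset.sum_congr rfl fun _ _ => by ring

theorem expect_sum {ι : Type*} (s : Finset ι) (f : ι → (α → ℕ) → ℝ) :
    expect q n (fun x => ∑ i ∈ s, f i x) = ∑ i ∈ s, expect q n (f i) := by
  simp only [expect, Finset.mul_sum]
  exact Finset.sum_comm

theorem expect_congr {f g : (α → ℕ) → ℝ} (h : ∀ x, ∑ a, x a = n → f x = g x) :
    expect q n f = expect q n g :=
  Finset.sum_congr rfl fun x hx => by rw [h x (Finset.mem_piAntidiag.1 hx).1]

theorem expect_mono (hq : ∀ a, 0 ≤ q a) {f g : (α → ℕ) → ℝ}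
    (h : ∀ x, ∑ a, x a = n → f x ≤ g x) : expect q n f ≤ expect q n g :=
  Finset.sum_le_sum fun x hx => mul_le_mul_of_nonneg_left (h x (Finset.mem_piAntidiag.1 hx).1)
    (multinomialProb_nonneg hq x)

theorem expect_one (hq : ∑ a, q a = 1) : expect q n (fun _ => 1) = 1 := by
  induction n with
  | zero => rw [expect_zero_size]
  | succ n ih => rw [expect_succ]; simp only [ih, mul_one, hq]

theorem expect_const (hq : ∑ a, q a = 1) (r : ℝ) : expect q n (fun _ => r) = r := by
  simpa [expect_one hq] using expect_const_mul (q := q) (n := n) r (fun _ => 1)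

theorem linForm_add_single (u : α → ℝ) (x : α → ℕ) (a : α) :
    linForm u (x + Pi.single a 1) = linForm u x + u a := by
  simp [linForm, add_mul, Finset.sum_add_distrib, Pi.single_apply]

variable {u v w z : α → ℝ}

theorem expect_linForm (hq : ∑ a, q a = 1) (hu : ∑ a, q a * u a = 0) :
    expect q n (linForm u) = 0 := by
  induction n with
  | zero => rw [expect_zero_size, linForm_zero]
  | succ n ih =>
    rw [expect_succ]
    simp only [linForm_add_single, expect_add, expect_const hq, mul_add, Finset.sum_add_distrib, hu]
    change ∑ a, q a * expect q n (linForm u) + 0 = 0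
    simp [ih]

/-- One more trial adds `u a` to each form. After multiplying out and averaging over `a`, every term
in which just one form receives the increment vanishes by centring. The higher moments follow the
same pattern. -/
theorem expect_linForm_mul_linForm (hq : ∑ a, q a = 1) (hu : ∑ a, q a * u a = 0)
    (hv : ∑ a, q a * v a = 0) :
    expect q n (fun x => linForm u x * linForm v x) = n * ∑ a, q a * (u a * v a) := by
  induction n with
  | zero => simp [expect_zero_size, linForm_zero]
  | succ n ih =>
    rw [expect_succ]
    have h : ∀ a, q a * expect q n
          (fun x => linForm u (x + Pi.single a 1) * linForm v (x + Pi.single a 1)) =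
        (n * ∑ b, q b * (u b * v b)) * q a + q a * (u a * v a) := by
      intro a
      have : (fun x => linForm u (x + Pi.single a 1) * linForm v (x + Pi.single a 1)) = fun x =>
          linForm u x * linForm v x + (v a * linForm u x + (u a * linForm v x + u a * v a)) := by
        ext x; simp only [linForm_add_single]; ring
      rw [this]
      simp only [expect_add, expect_const_mul, expect_const hq, ih, expect_linForm hq hu,
        expect_linForm hq hv]
      ring
    simp only [h, Finset.sum_add_distrib, ← Finset.mul_sum, hq]
    push_cast; ring

theorem expect_linForm_mul₃ (hq : ∑ a, q a = 1) (hu : ∑ a, q a * u a = 0)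
    (hv : ∑ a, q a * v a = 0) (hw : ∑ a, q a * w a = 0) :
    expect q n (fun x => linForm u x * linForm v x * linForm w x) =
      n * ∑ a, q a * (u a * v a * w a) := by
  induction n with
  | zero => simp [expect_zero_size, linForm_zero]
  | succ n ih =>
    rw [expect_succ]
    have h : ∀ a, q a * expect q n (fun x => linForm u (x + Pi.single a 1) *
          linForm v (x + Pi.single a 1) * linForm w (x + Pi.single a 1)) =
        (n * ∑ b, q b * (u b * v b * w b)) * q a + q a * (u a * v a * w a) +
        (n * ∑ b, q b * (u b * v b)) * (q a * w a) + (n * ∑ b, q b * (u b * w b)) * (q a * v a)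
        + (n * ∑ b, q b * (v b * w b)) * (q a * u a) := by
      intro a
      have : (fun x => linForm u (x + Pi.single a 1) * linForm v (x + Pi.single a 1) *
          linForm w (x + Pi.single a 1)) = fun x =>
          linForm u x * linForm v x * linForm w x + (w a * (linForm u x * linForm v x) +
          (v a * (linForm u x * linForm w x) + (u a * (linForm v x * linForm w x) +
          (v a * w a * linForm u x + (u a * w a * linForm v x + (u a * v a * linForm w x +
            u a * v a * w a)))))) := by
        ext x; simp only [linForm_add_single]; ring
      rw [this]
      simp only [expect_add, expect_const_mul, expect_const hq, ih, expect_linForm hq hu,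
        expect_linForm hq hv, expect_linForm hq hw, expect_linForm_mul_linForm hq hu hv,
        expect_linForm_mul_linForm hq hu hw, expect_linForm_mul_linForm hq hv hw]
      ring
    simp only [h, Finset.sum_add_distrib, ← Finset.mul_sum, hq, hu, hv, hw]
    push_cast; ring

theorem expect_linForm_mul₄ (hq : ∑ a, q a = 1) (hu : ∑ a, q a * u a = 0)
    (hv : ∑ a, q a * v a = 0) (hw : ∑ a, q a * w a = 0) (hz : ∑ a, q a * z a = 0) :
    expect q n (fun x => linForm u x * linForm v x * linForm w x * linForm z x) =
      n * (∑ a, q a * (u a * v a * w a * z a)) + n * (n - 1) *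
        ((∑ a, q a * (u a * v a)) * (∑ a, q a * (w a * z a)) +
          (∑ a, q a * (u a * w a)) * (∑ a, q a * (v a * z a)) +
          (∑ a, q a * (u a * z a)) * (∑ a, q a * (v a * w a))) := by
  induction n with
  | zero => simp [expect_zero_size, linForm_zero]
  | succ n ih =>
    rw [expect_succ]
    have h : ∀ a, q a * expect q n (fun x => linForm u (x + Pi.single a 1) *
          linForm v (x + Pi.single a 1) * linForm w (x + Pi.single a 1) *
          linForm z (x + Pi.single a 1)) =
        expect q n (fun x => linForm u x * linForm v x * linForm w x * linForm z x) * q a +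
        (n * ∑ b, q b * (u b * v b * w b)) * (q a * z a) +
        (n * ∑ b, q b * (u b * v b * z b)) * (q a * w a) +
        (n * ∑ b, q b * (u b * w b * z b)) * (q a * v a) +
        (n * ∑ b, q b * (v b * w b * z b)) * (q a * u a) +
        (n * ∑ b, q b * (u b * v b)) * (q a * (w a * z a)) +
        (n * ∑ b, q b * (u b * w b)) * (q a * (v a * z a)) +
        (n * ∑ b, q b * (u b * z b)) * (q a * (v a * w a)) +
        (n * ∑ b, q b * (v b * w b)) * (q a * (u a * z a)) +
        (n * ∑ b, q b * (v b * z b)) * (q a * (u a * w a)) +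
        (n * ∑ b, q b * (w b * z b)) * (q a * (u a * v a)) +
        q a * (u a * v a * w a * z a) := by
      intro a
      have : (fun x => linForm u (x + Pi.single a 1) * linForm v (x + Pi.single a 1) *
          linForm w (x + Pi.single a 1) * linForm z (x + Pi.single a 1)) = fun x =>
          linForm u x * linForm v x * linForm w x * linForm z x +
          (z a * (linForm u x * linForm v x * linForm w x) +
          (w a * (linForm u x * linForm v x * linForm z x) +
          (v a * (linForm u x * linForm w x * linForm z x) +
          (u a * (linForm v x * linForm w x * linForm z x) +
          (w a * z a * (linForm u x * linForm v x) + (v a * z a * (linForm u x * linForm w x) +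
          (v a * w a * (linForm u x * linForm z x) + (u a * z a * (linForm v x * linForm w x) +
          (u a * w a * (linForm v x * linForm z x) + (u a * v a * (linForm w x * linForm z x) +
          (v a * w a * z a * linForm u x + (u a * w a * z a * linForm v x +
          (u a * v a * z a * linForm w x + (u a * v a * w a * linForm z x +
            u a * v a * w a * z a)))))))))))))) := by
        ext x; simp only [linForm_add_single]; ring
      rw [this]
      simp only [expect_add, expect_const_mul, expect_const hq, expect_linForm hq hu,
        expect_linForm hq hv, expect_linForm hq hw, expect_linForm hq hz,
        expect_linForm_mul_linForm hq hu hv, expect_linForm_mul_linForm hq hu hw,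
        expect_linForm_mul_linForm hq hu hz, expect_linForm_mul_linForm hq hv hw,
        expect_linForm_mul_linForm hq hv hz, expect_linForm_mul_linForm hq hw hz,
        expect_linForm_mul₃ hq hu hv hw, expect_linForm_mul₃ hq hu hv hz,
        expect_linForm_mul₃ hq hu hw hz, expect_linForm_mul₃ hq hv hw hz]
      ring
    simp only [h, Finset.sum_add_distrib, ← Finset.mul_sum, hq, hu, hv, hw, hz, ih]
    push_cast; ring

theorem expect_linForm_pow_six (hq : ∑ a, q a = 1) (hu : ∑ a, q a * u a = 0) :
    expect q n (fun x => linForm u x ^ 6) =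
      n * (∑ a, q a * u a ^ 6) + n * (n - 1) *
        (15 * (∑ a, q a * u a ^ 2) * (∑ a, q a * u a ^ 4) + 10 * (∑ a, q a * u a ^ 3) ^ 2) +
      n * (n - 1) * (n - 2) * (15 * (∑ a, q a * u a ^ 2) ^ 3) := by
  have e2 : ∀ n, expect q n (fun x => linForm u x ^ 2) = n * ∑ a, q a * u a ^ 2 := fun n => by
    simpa only [pow_two] using expect_linForm_mul_linForm hq hu hu
  have e3 : ∀ n, expect q n (fun x => linForm u x ^ 3) = n * ∑ a, q a * u a ^ 3 := fun n => by
    simpa only [pow_succ, pow_zero, one_mul] using expect_linForm_mul₃ hq hu hu hu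
  have e4 : ∀ n, expect q n (fun x => linForm u x ^ 4) =
      n * (∑ a, q a * u a ^ 4) + n * (n - 1) * (3 * (∑ a, q a * u a ^ 2) ^ 2) := fun n => by
    have := expect_linForm_mul₄ (n := n) hq hu hu hu hu
    simp only [← pow_two, ← pow_succ] at this
    rw [this]; ring
  induction n with
  | zero => simp [expect_zero_size, linForm_zero]
  | succ n ih =>
    rw [expect_succ]
    -- The fifth moment needs no formula: its coefficient sums to `∑ a, q a * u a = 0`.
    have h : ∀ a, q a * expect q n (fun x => linForm u (x + Pi.single a 1) ^ 6) =
        expect q n (fun x => linForm u x ^ 6) * q a +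
        (6 * expect q n (fun x => linForm u x ^ 5)) * (q a * u a) +
        (15 * expect q n (fun x => linForm u x ^ 4)) * (q a * u a ^ 2) +
        (20 * expect q n (fun x => linForm u x ^ 3)) * (q a * u a ^ 3) +
        (15 * expect q n (fun x => linForm u x ^ 2)) * (q a * u a ^ 4) +
        q a * u a ^ 6 := by
      intro a
      have : (fun x => linForm u (x + Pi.single a 1) ^ 6) = fun x =>
          linForm u x ^ 6 + (6 * u a * linForm u x ^ 5 + (15 * u a ^ 2 * linForm u x ^ 4 +
          (20 * u a ^ 3 * linForm u x ^ 3 + (15 * u a ^ 4 * linForm u x ^ 2 +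
          (6 * u a ^ 5 * linForm u x + u a ^ 6))))) := by
        ext x; simp only [linForm_add_single]; ring
      rw [this]
      simp only [expect_add, expect_const_mul, expect_const hq, expect_linForm hq hu]
      ring
    simp only [h, Finset.sum_add_distrib, ← Finset.mul_sum, hq, hu, ih, e2, e3, e4]
    push_cast; ring

end Expect

/-! ### Calculus of second-order expansions in 1/n -/

section Expansion

variable {R R' : ℕ → ℝ} {a b a' b' : ℝ}

theorem hasExpansion_iff_tendsto : HasExpansion R a b ↔
    Tendsto (fun n : ℕ => (n : ℝ) ^ 2 * R n - (a * n + b)) atTop (𝓝 0) := by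
  rw [HasExpansion, isLittleO_iff_tendsto']
  · refine tendsto_congr' ?_
    filter_upwards [eventually_gt_atTop 0] with n hn
    have : (n : ℝ) ≠ 0 := by positivity
    field_simp
  · filter_upwards [eventually_gt_atTop 0] with n hn h
    have : (0 : ℝ) < n := by positivity
    exact absurd h (by positivity)

theorem HasExpansion.congr (h : HasExpansion R a b) (hR : ∀ᶠ n in atTop, R n = R' n) :
    HasExpansion R' a b := by
  rw [hasExpansion_iff_tendsto] at h ⊢
  refine h.congr' ?_
  filter_upwards [hR] with n hn
  rw [hn]

theorem HasExpansion.add (h : HasExpansion R a b) (h' : HasExpansion R' a' b') :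
    HasExpansion (fun n => R n + R' n) (a + a') (b + b') := by
  rw [hasExpansion_iff_tendsto] at h h' ⊢
  have := h.add h'
  rw [add_zero] at this
  exact this.congr fun n => by ring

theorem HasExpansion.const_mul (h : HasExpansion R a b) (r : ℝ) :
    HasExpansion (fun n => r * R n) (r * a) (r * b) := by
  rw [hasExpansion_iff_tendsto] at h ⊢
  have := h.const_mul r
  rw [mul_zero] at this
  exact this.congr fun n => by ring

theorem HasExpansion.sub (h : HasExpansion R a b) (h' : HasExpansion R' a' b') :
    HasExpansion (fun n => R n - R' n) (a - a') (b - b') := by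
  rw [hasExpansion_iff_tendsto] at h h' ⊢
  have := h.sub h'
  rw [sub_zero] at this
  exact this.congr fun n => by ring

theorem hasExpansion_zero : HasExpansion (fun _ => 0) 0 0 := by
  simp [hasExpansion_iff_tendsto]

theorem HasExpansion.sum {ι : Type*} {s : Finset ι} {R : ι → ℕ → ℝ} {a b : ι → ℝ}
    (h : ∀ i ∈ s, HasExpansion (R i) (a i) (b i)) :
    HasExpansion (fun n => ∑ i ∈ s, R i n) (∑ i ∈ s, a i) (∑ i ∈ s, b i) := by
  classical
  induction s using Finset.induction_on with
  | empty => simpa using hasExpansion_zero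
  | insert i s hi ih =>
    simp only [Finset.sum_insert hi]
    exact (h i (by simp)).add (ih fun j hj => h j (by simp [hj]))

theorem HasExpansion.squeeze {lo hi : ℕ → ℝ} (h : HasExpansion lo a b) (h' : HasExpansion hi a b)
    (hl : ∀ᶠ n in atTop, lo n ≤ R n) (hh : ∀ᶠ n in atTop, R n ≤ hi n) : HasExpansion R a b := by
  rw [hasExpansion_iff_tendsto] at h h' ⊢
  refine tendsto_of_tendsto_of_tendsto_of_le_of_le' h h' ?_ ?_
  · filter_upwards [hl] with n hn
    gcongr
  · filter_upwards [hh] with n hn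
    gcongr

theorem HasExpansion.tendsto_mul (h : HasExpansion R a b) :
    Tendsto (fun n : ℕ => n * R n) atTop (𝓝 a) := by
  rw [hasExpansion_iff_tendsto] at h
  have hi : Tendsto (fun n : ℕ => ((n : ℝ))⁻¹) atTop (𝓝 0) := tendsto_inv_atTop_nhds_zero_nat
  have := ((h.mul hi).add (hi.const_mul b)).add_const a
  simp only [mul_zero, zero_add] at this
  refine this.congr' ?_
  filter_upwards [eventually_gt_atTop 0] with n hn
  have : (n : ℝ) ≠ 0 := by positivity
  field_simp
  ring

theorem HasExpansion.unique_fst (h : HasExpansion R a b) (h' : HasExpansion R a' b') : a = a' :=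
  tendsto_nhds_unique h.tendsto_mul h'.tendsto_mul

theorem HasExpansion.unique_snd (h : HasExpansion R a b) (h' : HasExpansion R a' b') : b = b' := by
  obtain rfl := h.unique_fst h'
  rw [hasExpansion_iff_tendsto] at h h'
  have := h.sub h'
  simp only [sub_sub_sub_cancel_left, add_sub_add_left_eq_sub, sub_zero] at this
  have := tendsto_nhds_unique tendsto_const_nhds this
  linarith

theorem hasExpansion_div_add_div : HasExpansion (fun n : ℕ => a / n + b / (n : ℝ) ^ 2) a b := by
  simp [HasExpansion]

theorem hasExpansion_of_tendsto (h : Tendsto (fun n : ℕ => (n : ℝ) ^ 2 * R n) atTop (𝓝 b)) :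
    HasExpansion R 0 b := by
  rw [hasExpansion_iff_tendsto]
  simpa using h.sub_const b

theorem HasExpansion.tendsto_sq_mul (h : HasExpansion R 0 b) :
    Tendsto (fun n : ℕ => (n : ℝ) ^ 2 * R n) atTop (𝓝 b) := by
  rw [hasExpansion_iff_tendsto] at h
  simpa using h.add_const b

end Expansion

/-! ### Moments of the deviation of the relative frequencies -/

section Deviation

variable {α : Type*} [Fintype α]

/-- The deviation of the relative frequencies from `p`. -/
def deviation (p : α → ℝ) (x : α → ℕ) : α → ℝ := fun a => (x a : ℝ) / (∑ b, x b : ℕ) - p a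

variable [DecidableEq α] {p : α → ℝ} {n : ℕ}

/-- The deviation is the average over the trials of the centred indicator vectors of the observed
cells, so any linear functional of it is a centred linear form of the counts divided by n. -/
theorem map_deviation (ℓ : (α → ℝ) →ₗ[ℝ] ℝ) {x : α → ℕ} (hx : ∑ b, x b = n) (hn : n ≠ 0) :
    ℓ (deviation p x) = linForm (fun b => ℓ (Pi.single b 1 - p)) x / n := by
  have hn' : (n : ℝ) ≠ 0 := by positivity
  have h : deviation p x = (n : ℝ)⁻¹ • ∑ b, (x b : ℝ) • (Pi.single b 1 - p) := by
    ext a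
    have hx' : ∑ b, (x b : ℝ) = n := by exact_mod_cast hx
    simp only [deviation, hx, Pi.smul_apply, Finset.sum_apply, Pi.sub_apply, smul_eq_mul, mul_sub,
      Finset.sum_sub_distrib, ← Finset.sum_mul, hx', Pi.single_apply]
    simp
    field_simp
  rw [h, map_smul, map_sum, linForm]
  simp only [map_smul, smul_eq_mul]
  rw [div_eq_inv_mul]

theorem sum_mul_map_single_sub (hp : ∑ a, p a = 1) (ℓ : (α → ℝ) →ₗ[ℝ] ℝ) :
    ∑ b, p b * ℓ (Pi.single b 1 - p) = 0 := by
  have : ∑ b, p b • ((Pi.single b 1 : α → ℝ) - p) = 0 := by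
    ext a
    simp [mul_sub, Finset.sum_sub_distrib, ← Finset.sum_mul, hp, Pi.single_apply]
  have := congrArg ℓ this
  simpa [map_sum] using this

theorem expect_map_deviation_sq (hp : ∑ a, p a = 1) (ℓ : (α → ℝ) →ₗ[ℝ] ℝ) (hn : n ≠ 0) :
    expect p n (fun x => ℓ (deviation p x) ^ 2) =
      (∑ b, p b * ℓ (Pi.single b 1 - p) ^ 2) / n := by
  have hn' : (n : ℝ) ≠ 0 := by positivity
  have h := sum_mul_map_single_sub hp ℓ
  have h2 := expect_linForm_mul_linForm (n := n) hp h h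
  rw [expect_congr (g := fun x => ((n : ℝ) ^ 2)⁻¹ *
    (linForm (fun b => ℓ (Pi.single b 1 - p)) x * linForm (fun b => ℓ (Pi.single b 1 - p)) x)),
    expect_const_mul, h2]
  · simp only [← pow_two]
    field_simp
  · intro x hx
    rw [map_deviation ℓ hx hn]
    field_simp

/-- The expectation of a product of `k + 1` linear forms of the deviation has an expansion
for `k < 4`. -/
theorem exists_hasExpansion_prod (hp : ∑ a, p a = 1) {k : ℕ} (hk : k < 4)
    (ℓ : Fin (k + 1) → (α → ℝ) →ₗ[ℝ] ℝ) :
    ∃ a b, HasExpansion (fun n => expect p n fun x => ∏ i, ℓ i (deviation p x)) a b := by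
  have h := fun i => sum_mul_map_single_sub hp (ℓ i)
  have key : ∀ n : ℕ, n ≠ 0 → expect p n (fun x => ∏ i, ℓ i (deviation p x)) =
      ((n : ℝ) ^ (k + 1))⁻¹ *
        expect p n fun x => ∏ i, linForm (fun b => ℓ i (Pi.single b 1 - p)) x := by
    intro n hn
    rw [← expect_const_mul]
    refine expect_congr fun x hx => ?_
    simp only [map_deviation _ hx hn, Finset.prod_div_distrib, Finset.prod_const, Finset.card_univ,
      Fintype.card_fin]
    rw [div_eq_inv_mul]
  have hev : ∀ᶠ n : ℕ in atTop, n ≠ 0 := eventually_ne_atTop 0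
  obtain rfl | rfl | rfl | rfl : k = 0 ∨ k = 1 ∨ k = 2 ∨ k = 3 := by omega
  · refine ⟨0, 0, hasExpansion_zero.congr ?_⟩
    filter_upwards [hev] with n hn
    rw [key n hn]
    have e : (fun x => ∏ i, linForm (fun b => ℓ i (Pi.single b 1 - p)) x) =
        linForm (fun b => ℓ 0 (Pi.single b 1 - p)) := by
      ext x
      exact Fin.prod_univ_one fun i => linForm (fun b => ℓ i (Pi.single b 1 - p)) x
    rw [e, expect_linForm hp (h 0), mul_zero]
  · obtain ⟨A, hA⟩ : ∃ A : ℝ, ∀ n : ℕ, expect p n _ = n * A :=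
      ⟨_, fun n => expect_linForm_mul_linForm hp (h 0) (h 1)⟩
    refine ⟨A, 0, hasExpansion_div_add_div.congr ?_⟩
    filter_upwards [hev] with n hn
    have hn' : (n : ℝ) ≠ 0 := by positivity
    rw [key n hn]
    rw [show (fun x => ∏ i, linForm (fun b => ℓ i (Pi.single b 1 - p)) x) = _ from funext fun x =>
      Fin.prod_univ_two fun i => linForm (fun b => ℓ i (Pi.single b 1 - p)) x, hA]
    field_simp
    ring
  · obtain ⟨A, hA⟩ : ∃ A : ℝ, ∀ n : ℕ, expect p n _ = n * A :=
      ⟨_, fun n => expect_linForm_mul₃ hp (h 0) (h 1) (h 2)⟩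
    refine ⟨0, A, hasExpansion_div_add_div.congr ?_⟩
    filter_upwards [hev] with n hn
    have hn' : (n : ℝ) ≠ 0 := by positivity
    rw [key n hn]
    rw [show (fun x => ∏ i, linForm (fun b => ℓ i (Pi.single b 1 - p)) x) = _ from funext fun x =>
      Fin.prod_univ_three fun i => linForm (fun b => ℓ i (Pi.single b 1 - p)) x, hA]
    field_simp
    ring
  · obtain ⟨A, B, hA⟩ : ∃ A B : ℝ, ∀ n : ℕ, expect p n _ = n * A + n * (n - 1) * B :=
      ⟨_, _, fun n => expect_linForm_mul₄ hp (h 0) (h 1) (h 2) (h 3)⟩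
    -- The value is written as the limit of A/n + (1 - 1/n)B: of the fourth moment, only the part
    -- quadratic in n survives the division by n⁴ at order n⁻².
    refine ⟨0, 0 * A + (1 - 0) * B, hasExpansion_of_tendsto ?_⟩
    have hi : Tendsto (fun n : ℕ => ((n : ℝ))⁻¹) atTop (𝓝 0) := tendsto_inv_atTop_nhds_zero_nat
    refine Tendsto.congr' ?_ ((hi.mul_const A).add ((hi.const_sub 1).mul_const B))
    filter_upwards [hev] with n hn
    have hn' : (n : ℝ) ≠ 0 := by positivity
    rw [key n hn]
    rw [show (fun x => ∏ i, linForm (fun b => ℓ i (Pi.single b 1 - p)) x) = _ from funext fun x =>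
      Fin.prod_univ_four fun i => linForm (fun b => ℓ i (Pi.single b 1 - p)) x, hA]
    field_simp
    ring

theorem deviation_eq_sum (x : α → ℕ) :
    deviation p x = ∑ b, deviation p x b • (Pi.single b 1 : α → ℝ) := by
  ext a
  simp [Finset.sum_apply, Pi.single_apply]

theorem exists_hasExpansion_multilinear (hp : ∑ a, p a = 1) {k : ℕ} (hk : k < 4)
    (T : MultilinearMap ℝ (fun _ : Fin (k + 1) => α → ℝ) ℝ) :
    ∃ a b, HasExpansion (fun n => expect p n fun x => T fun _ => deviation p x) a b := by
  have hT : ∀ x : α → ℕ, (T fun _ => deviation p x) = ∑ r : Fin (k + 1) → α,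
      (T fun i => Pi.single (r i) 1) *
        ∏ i, (LinearMap.proj (r i) : (α → ℝ) →ₗ[ℝ] ℝ) (deviation p x) := by
    intro x
    conv_lhs => rw [deviation_eq_sum]
    rw [T.map_sum]
    refine Finset.sum_congr rfl fun r _ => ?_
    rw [T.map_smul_univ, smul_eq_mul, mul_comm]
    simp
  choose a b h using fun r : Fin (k + 1) → α => exists_hasExpansion_prod hp hk
    fun i => (LinearMap.proj (r i) : (α → ℝ) →ₗ[ℝ] ℝ)
  refine ⟨_, _, (HasExpansion.sum (s := univ) fun r _ =>
    (h r).const_mul (T fun i => Pi.single (r i) 1)).congr (Eventually.of_forall fun n => ?_)⟩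
  simp only [hT, expect_sum, expect_const_mul]

theorem tendsto_sq_mul_expect_deviation_pow_four (hp : ∑ a, p a = 1) (c : α) :
    ∃ K, Tendsto (fun n : ℕ => (n : ℝ) ^ 2 * expect p n fun x => deviation p x c ^ 4) atTop
      (𝓝 K) := by
  have h := sum_mul_map_single_sub hp (LinearMap.proj c)
  have hi : Tendsto (fun n : ℕ => ((n : ℝ))⁻¹) atTop (𝓝 0) := tendsto_inv_atTop_nhds_zero_nat
  obtain ⟨A, B, hA⟩ : ∃ A B : ℝ, ∀ n : ℕ, expect p n _ = n * A + n * (n - 1) * B :=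
    ⟨_, _, fun n => expect_linForm_mul₄ hp h h h h⟩
  refine ⟨0 * A + (1 - 0) * B,
    Tendsto.congr' ?_ ((hi.mul_const A).add ((hi.const_sub 1).mul_const B))⟩
  filter_upwards [eventually_ne_atTop 0] with n hn
  have hn' : (n : ℝ) ≠ 0 := by positivity
  rw [expect_congr (g := fun x => ((n : ℝ) ^ 4)⁻¹ *
    (linForm (fun b => (LinearMap.proj c : (α → ℝ) →ₗ[ℝ] ℝ) (Pi.single b 1 - p)) x *
      linForm (fun b => (LinearMap.proj c : (α → ℝ) →ₗ[ℝ] ℝ) (Pi.single b 1 - p)) x *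
      linForm (fun b => (LinearMap.proj c : (α → ℝ) →ₗ[ℝ] ℝ) (Pi.single b 1 - p)) x *
      linForm (fun b => (LinearMap.proj c : (α → ℝ) →ₗ[ℝ] ℝ) (Pi.single b 1 - p)) x)),
    expect_const_mul, hA]
  · field_simp
  · intro x hx
    have := map_deviation (LinearMap.proj c) (p := p) hx hn
    rw [LinearMap.proj_apply] at this
    rw [this]
    field_simp

theorem tendsto_cube_mul_expect_deviation_pow_six (hp : ∑ a, p a = 1) (c : α) :
    ∃ K, Tendsto (fun n : ℕ => (n : ℝ) ^ 3 * expect p n fun x => deviation p x c ^ 6) atTop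
      (𝓝 K) := by
  have h := sum_mul_map_single_sub hp (LinearMap.proj c)
  have hi : Tendsto (fun n : ℕ => ((n : ℝ))⁻¹) atTop (𝓝 0) := tendsto_inv_atTop_nhds_zero_nat
  obtain ⟨A, B, C, hA⟩ : ∃ A B C : ℝ, ∀ n : ℕ, expect p n _ =
      n * A + n * (n - 1) * B + n * (n - 1) * (n - 2) * C :=
    ⟨_, _, _, fun n => expect_linForm_pow_six hp h⟩
  refine ⟨0 ^ 2 * A + 0 * (1 - 0) * B + (1 - 0) * (1 - 2 * 0) * C,
    Tendsto.congr' ?_ ((((hi.pow 2).mul_const A).add ((hi.mul (hi.const_sub 1)).mul_const B)).add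
      (((hi.const_sub 1).mul ((hi.const_mul 2).const_sub 1)).mul_const C))⟩
  filter_upwards [eventually_ne_atTop 0] with n hn
  have hn' : (n : ℝ) ≠ 0 := by positivity
  rw [expect_congr (g := fun x => ((n : ℝ) ^ 6)⁻¹ *
    linForm (fun b => (LinearMap.proj c : (α → ℝ) →ₗ[ℝ] ℝ) (Pi.single b 1 - p)) x ^ 6),
    expect_const_mul, hA]
  · field_simp
  · intro x hx
    have := map_deviation (LinearMap.proj c) (p := p) hx hn
    rw [LinearMap.proj_apply] at this
    rw [this]
    field_simp

/-- An odd absolute moment is not accessible to the recursion, so it is interpolated between the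
fourth and the sixth: multiply |t| ≤ ε + t²/ε by t⁴. -/
theorem abs_pow_five_le {t ε : ℝ} (hε : 0 < ε) : |t| ^ 5 ≤ ε * t ^ 4 + ε⁻¹ * t ^ 6 := by
  have h4 : t ^ 4 = |t| ^ 4 := (Even.pow_abs (by decide) t).symm
  have h6 : t ^ 6 = |t| ^ 6 := (Even.pow_abs (by decide) t).symm
  rw [h4, h6]
  have hs : |t| ≤ ε + ε⁻¹ * |t| ^ 2 := by
    have h1 := abs_nonneg t
    rw [← sub_nonneg]
    have : ε + ε⁻¹ * |t| ^ 2 - |t| = ε⁻¹ * ((ε - |t|) ^ 2 + ε * |t|) := by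
      field_simp; ring
    rw [this]; positivity
  calc |t| ^ 5 = |t| ^ 4 * |t| := by ring
    _ ≤ |t| ^ 4 * (ε + ε⁻¹ * |t| ^ 2) := by gcongr
    _ = _ := by ring

theorem hasExpansion_abs_deviation_pow_five (hp0 : ∀ a, 0 ≤ p a) (hp : ∑ a, p a = 1) (c : α) :
    HasExpansion (fun n => expect p n fun x => |deviation p x c| ^ 5) 0 0 := by
  obtain ⟨K, hK⟩ := tendsto_sq_mul_expect_deviation_pow_four hp c
  obtain ⟨K', hK'⟩ := tendsto_cube_mul_expect_deviation_pow_six hp c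
  refine hasExpansion_of_tendsto ?_
  have hi : Tendsto (fun n : ℕ => (√(n : ℝ))⁻¹) atTop (𝓝 0) :=
    tendsto_inv_atTop_zero.comp (Real.tendsto_sqrt_atTop.comp tendsto_natCast_atTop_atTop)
  have hlim := (hi.mul hK).add (hi.mul hK')
  simp only [zero_mul, add_zero] at hlim
  refine tendsto_of_tendsto_of_tendsto_of_le_of_le' tendsto_const_nhds hlim
    (Eventually.of_forall fun n => ?_) ?_
  · have : expect p n (fun _ => 0) ≤ expect p n fun x => |deviation p x c| ^ 5 :=
      expect_mono hp0 fun x _ => by positivity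
    rw [expect_const hp] at this
    positivity
  · filter_upwards [eventually_gt_atTop 0] with n hn
    have hn' : (0 : ℝ) < n := by positivity
    have hs : 0 < √(n : ℝ) := Real.sqrt_pos.2 hn'
    -- The choice ε = 1/√n balances the two terms: both become O(n^(-5/2)).
    have : expect p n (fun x => |deviation p x c| ^ 5) ≤
        expect p n fun x => (√(n : ℝ))⁻¹ * deviation p x c ^ 4 +
          (√(n : ℝ))⁻¹⁻¹ * deviation p x c ^ 6 :=
      expect_mono hp0 fun x _ => abs_pow_five_le (by positivity)
    rw [expect_add, expect_const_mul, expect_const_mul, inv_inv] at this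
    refine (mul_le_mul_of_nonneg_left this (by positivity)).trans (le_of_eq ?_)
    · · have h2 : (n : ℝ) = √(n : ℝ) ^ 2 := (Real.sq_sqrt hn'.le).symm
        rw [mul_add]
        congr 1
        · ring
        · have : (n : ℝ) ^ 3 = n ^ 2 * √(n : ℝ) ^ 2 := by rw [← h2]; ring
          rw [this]
          field_simp

/-- Second moments are of order 1/n and fourth moments of order 1/n², so only the term with the
arbitrarily small ε is felt at order 1/n. This serves to identify the leading coefficient of the
risk. -/
theorem tendsto_mul_expect_of_abs_le (hp0 : ∀ a, 0 ≤ p a) (hp : ∑ a, p a = 1)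
    {f : (α → ℕ) → ℝ} (hf : ∀ ε > 0, ∃ C, ∀ x, ∑ a, x a ≠ 0 →
      |f x| ≤ ε * (∑ c, deviation p x c ^ 2) + C * ∑ c, deviation p x c ^ 4) :
    Tendsto (fun n : ℕ => n * expect p n f) atTop (𝓝 0) := by
  choose K hK using tendsto_sq_mul_expect_deviation_pow_four hp
  set V := ∑ c, ∑ b, p b * (LinearMap.proj c : (α → ℝ) →ₗ[ℝ] ℝ) (Pi.single b 1 - p) ^ 2 with hV
  have hV0 : 0 ≤ V := Finset.sum_nonneg fun c _ => Finset.sum_nonneg fun b _ =>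
    mul_nonneg (hp0 b) (sq_nonneg _)
  have h2 : ∀ n : ℕ, n ≠ 0 → n * expect p n (fun x => ∑ c, deviation p x c ^ 2) = V := by
    intro n hn
    have hn' : (n : ℝ) ≠ 0 := by positivity
    rw [expect_sum, hV, Finset.mul_sum]
    refine Finset.sum_congr rfl fun c _ => ?_
    have := expect_map_deviation_sq hp (LinearMap.proj c) hn
    simp only [LinearMap.proj_apply] at this ⊢
    rw [this]
    field_simp
  have hi : Tendsto (fun n : ℕ => ((n : ℝ))⁻¹) atTop (𝓝 0) := tendsto_inv_atTop_nhds_zero_nat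
  rw [Metric.tendsto_atTop]
  intro ε hε
  -- The second moments contribute V in total after multiplication by n; V + 1 keeps the divisor
  -- positive if V = 0.
  obtain ⟨C, hC⟩ := hf (ε / (2 * (V + 1))) (by positivity)
  have h4 : Tendsto (fun n : ℕ => (n : ℝ)⁻¹ * (C * ∑ c, (n : ℝ) ^ 2 *
      expect p n fun x => deviation p x c ^ 4)) atTop (𝓝 0) := by
    simpa using hi.mul ((tendsto_finsetSum univ fun c _ => hK c).const_mul C)
  obtain ⟨N, hN⟩ := (h4.eventually_lt_const (half_pos hε)).exists_forall_of_atTop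
  refine ⟨N + 1, fun n hn => ?_⟩
  have hn0 : n ≠ 0 := by omega
  have hn' : (0 : ℝ) < n := by positivity
  have hub : expect p n (fun x => ε / (2 * (V + 1)) * (∑ c, deviation p x c ^ 2) +
      C * ∑ c, deviation p x c ^ 4) * n < ε := by
    rw [expect_add, expect_const_mul, expect_const_mul, add_mul, mul_assoc, mul_comm _ (n : ℝ),
      h2 n hn0]
    have h1 : ε / (2 * (V + 1)) * V ≤ ε / 2 := by
      rw [div_mul_eq_mul_div, div_le_div_iff₀ (by positivity) (by positivity)]
      nlinarith
    have h3 := hN n (by omega)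
    have e : (n : ℝ)⁻¹ * (C * ∑ c, (n : ℝ) ^ 2 * expect p n fun x => deviation p x c ^ 4) =
        C * expect p n (fun x => ∑ c, deviation p x c ^ 4) * n := by
      rw [expect_sum, ← Finset.mul_sum]
      field_simp
    rw [e] at h3
    linarith
  have hle : ∀ g : (α → ℕ) → ℝ, (∀ x, ∑ a, x a = n → g x ≤ |f x|) → n * expect p n g < ε := by
    intro g hg
    rw [mul_comm]
    refine lt_of_le_of_lt ?_ hub
    gcongr
    exact expect_mono hp0 fun x hx => (hg x hx).trans (hC x (by omega))
  have h1 := hle f fun x _ => le_abs_self _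
  have h2 := hle (fun x => -1 * f x) fun x _ => by rw [neg_one_mul]; exact neg_le_abs _
  rw [expect_const_mul] at h2
  rw [Real.dist_eq, sub_zero, abs_lt]
  constructor <;> linarith

end Deviation

/-! ### Likelihood, divergence and consistency -/

section KullbackLeibler

variable {α : Type*} [Fintype α]

/-- `q` is a maximizer of the likelihood of the data `x` over the closure of the model `M`. -/
def IsMaxLik (M : Set (α → ℝ)) (x : α → ℕ) (q : α → ℝ) : Prop :=
  q ∈ closure M ∧ ∀ r ∈ M, multinomialProb r x ≤ multinomialProb q x

theorem continuous_klDivergence {p : α → ℝ} (hp : ∀ a, 0 < p a) :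
    Continuous fun q => klDivergence q p := by
  have : (fun q => klDivergence q p) =
      fun q => ∑ a, p a * (q a / p a * Real.log (q a / p a)) := by
    ext q
    refine Finset.sum_congr rfl fun a _ => ?_
    have := (hp a).ne'
    field_simp
  rw [this]
  refine continuous_finsetSum _ fun a _ => continuous_const.mul ?_
  exact Real.continuous_mul_log.comp ((continuous_apply a).div_const _)

theorem klDivergence_self {p : α → ℝ} : klDivergence p p = 0 := by
  refine Finset.sum_eq_zero fun a _ => ?_
  rcases eq_or_ne (p a) 0 with h | h <;> simp [h]

/-- The likelihood ratio controls the Hellinger distance. -/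
theorem sum_sq_sqrt_sub_sqrt_le {f q p : α → ℝ} (hf : ∀ a, 0 < f a) (hf1 : ∑ a, f a = 1)
    (hq : ∀ a, 0 < q a) (hq1 : ∑ a, q a = 1) (hp : ∀ a, 0 < p a)
    (h : ∑ a, f a * Real.log (p a) ≤ ∑ a, f a * Real.log (q a)) :
    ∑ a, (√(f a) - √(q a)) ^ 2 ≤ klDivergence f p := by
  have h1 : ∀ a, (√(f a) - √(q a)) ^ 2 ≤ f a * Real.log (f a) - f a * Real.log (q a) -
      (f a - q a) := by
    intro a
    have hs := Real.sqrt_pos.2 (hf a)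
    have hs' := Real.sqrt_pos.2 (hq a)
    -- The inequality log t ≤ t - 1 at t = √(q/f) bounds squared Hellinger distance by divergence
    -- cell by cell, up to the term f - q, which cancels in the sum.
    have := Real.log_le_sub_one_of_pos (div_pos hs' hs)
    rw [Real.log_div hs'.ne' hs.ne', Real.log_sqrt (hf a).le, Real.log_sqrt (hq a).le] at this
    have h2 := mul_le_mul_of_nonneg_left this (hf a).le
    have h3 : f a * (√(q a) / √(f a) - 1) = √(f a) * √(q a) - f a := by
      have h4 : f a * (√(q a) / √(f a)) = √(f a) * √(q a) := by
        nth_rewrite 1 [← Real.mul_self_sqrt (hf a).le]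
        field_simp
      rw [mul_sub, h4, mul_one]
    rw [h3] at h2
    have e1 := Real.sq_sqrt (hf a).le
    have e2 := Real.sq_sqrt (hq a).le
    nlinarith
  calc _ ≤ ∑ a, (f a * Real.log (f a) - f a * Real.log (q a) - (f a - q a)) :=
        Finset.sum_le_sum fun a _ => h1 a
    _ = ∑ a, f a * Real.log (f a) - ∑ a, f a * Real.log (q a) := by
        simp only [Finset.sum_sub_distrib, hf1, hq1]; ring
    _ ≤ ∑ a, f a * Real.log (f a) - ∑ a, f a * Real.log (p a) := by gcongr
    _ = klDivergence f p := by
        rw [klDivergence, ← Finset.sum_sub_distrib]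
        refine Finset.sum_congr rfl fun a _ => ?_
        rw [Real.log_div (hf a).ne' (hp a).ne']
        ring

theorem log_multinomialProb_le_iff {q r : α → ℝ} {x : α → ℕ} (hq : ∀ a, 0 < q a)
    (hr : ∀ a, 0 < r a) :
    multinomialProb q x ≤ multinomialProb r x ↔
      ∑ a, (x a : ℝ) * Real.log (q a) ≤ ∑ a, (x a : ℝ) * Real.log (r a) := by
  have e : ∀ q : α → ℝ, (∀ a, 0 < q a) →
      Real.log (∏ a, q a ^ x a) = ∑ a, (x a : ℝ) * Real.log (q a) := by
    intro q hq
    rw [Real.log_prod (fun a _ => (pow_pos (hq a) _).ne')]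
    simp [Real.log_pow]
  rw [← e q hq, ← e r hr, Real.log_le_log_iff (Finset.prod_pos fun a _ => pow_pos (hq a) _)
    (Finset.prod_pos fun a _ => pow_pos (hr a) _), multinomialProb, multinomialProb]
  have : (0 : ℝ) < Nat.multinomial univ x := by exact_mod_cast Nat.multinomial_pos _ _
  exact mul_le_mul_iff_right₀ this

/-- The vector of relative frequencies of the counts `x`. -/
def relFreq (x : α → ℕ) : α → ℝ := fun a => (x a : ℝ) / (∑ b, x b : ℕ)

theorem deviation_eq (p : α → ℝ) (x : α → ℕ) : deviation p x = relFreq x - p := rfl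

theorem sum_relFreq {x : α → ℕ} (hx : ∑ a, x a ≠ 0) : ∑ a, relFreq x a = 1 := by
  simp only [relFreq, ← Finset.sum_div, ← Nat.cast_sum]
  exact div_self (by exact_mod_cast hx)

theorem relFreq_nonneg (x : α → ℕ) (a : α) : 0 ≤ relFreq x a := by
  unfold relFreq; positivity

theorem multinomialProb_pos {q : α → ℝ} (hq : ∀ a, 0 < q a) (x : α → ℕ) :
    0 < multinomialProb q x :=
  mul_pos (by exact_mod_cast Nat.multinomial_pos _ _) (Finset.prod_pos fun a _ => pow_pos (hq a) _)

theorem closure_subset_simplex {M : Set (α → ℝ)}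
    (hM : ∀ r ∈ M, (∀ a, 0 < r a) ∧ ∑ a, r a = 1) {q : α → ℝ} (hq : q ∈ closure M) :
    (∀ a, 0 ≤ q a) ∧ ∑ a, q a = 1 := by
  have hc : IsClosed {q : α → ℝ | (∀ a, 0 ≤ q a) ∧ ∑ a, q a = 1} := by
    rw [Set.ofPred_and, Set.ofPred_forall]
    exact (isClosed_iInter fun a => isClosed_le continuous_const (continuous_apply a)).inter
      (isClosed_eq (by fun_prop) continuous_const)
  have hsub : M ⊆ {q : α → ℝ | (∀ a, 0 ≤ q a) ∧ ∑ a, q a = 1} :=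
    fun r hr => ⟨fun a => ((hM r hr).1 a).le, (hM r hr).2⟩
  exact closure_minimal hsub hc hq

theorem IsMaxLik.pos {M : Set (α → ℝ)} (hM : ∀ r ∈ M, (∀ a, 0 < r a) ∧ ∑ a, r a = 1)
    {p : α → ℝ} (hp : p ∈ M) {x : α → ℕ} {q : α → ℝ} (h : IsMaxLik M x q) {a : α}
    (hx : x a ≠ 0) : 0 < q a := by
  refine lt_of_le_of_ne ((closure_subset_simplex hM h.1).1 a) fun h0 => ?_
  have h1 := (multinomialProb_pos (hM p hp).1 x).trans_le (h.2 p hp)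
  rw [multinomialProb, Finset.prod_eq_zero (Finset.mem_univ a) (by rw [← h0, zero_pow hx])] at h1
  simp at h1

/-- Consistency of maximum likelihood estimation. -/
theorem eventually_dist_lt_of_isMaxLik {M : Set (α → ℝ)}
    (hM : ∀ r ∈ M, (∀ a, 0 < r a) ∧ ∑ a, r a = 1) {p : α → ℝ} (hp : p ∈ M) {ε : ℝ} (hε : 0 < ε) :
    ∀ᶠ f in 𝓝 p, ∀ x q, relFreq x = f → ∑ a, x a ≠ 0 → IsMaxLik M x q → dist q p < ε := by
  have hp0 := (hM p hp).1
  -- Since |q - f| = |√q - √f|(√q + √f) ≤ 2|√q - √f|, this makes q within ε/2 of f; the other ε/2 is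
  -- the distance from f to p.
  have h1 : ∀ᶠ f in 𝓝 p, klDivergence f p < (ε / 4) ^ 2 :=
    (continuous_klDivergence hp0).continuousAt.eventually_lt_const
      (by beta_reduce; rw [klDivergence_self]; positivity)
  have h2 : ∀ᶠ f in 𝓝 p, ∀ a, 0 < f a :=
    Filter.eventually_all.2 fun a => (continuous_apply a).continuousAt.eventually_const_lt (hp0 a)
  filter_upwards [h1, h2, Metric.ball_mem_nhds p (half_pos hε)] with f hf1 hf2 hf3
  rintro x q rfl hx hq
  have hN : (0 : ℝ) < (∑ b, x b : ℕ) := by exact_mod_cast Nat.pos_of_ne_zero hx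
  have hxa : ∀ a, x a ≠ 0 := fun a h0 => by
    have := hf2 a
    simp [relFreq, h0] at this
  have hq0 : ∀ a, 0 < q a := fun a => hq.pos hM hp (hxa a)
  have hq1 := (closure_subset_simplex hM hq.1).2
  have hlog := (log_multinomialProb_le_iff hp0 hq0).1 (hq.2 p hp)
  have hlog' : ∑ a, relFreq x a * Real.log (p a) ≤ ∑ a, relFreq x a * Real.log (q a) := by
    simp only [relFreq, div_mul_eq_mul_div, ← Finset.sum_div]
    gcongr
  have hH := (sum_sq_sqrt_sub_sqrt_le hf2 (sum_relFreq hx) hq0 hq1 hp0 hlog').trans_lt hf1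
  have hle1 : ∀ {r : α → ℝ}, (∀ a, 0 < r a) → ∑ a, r a = 1 → ∀ a, √(r a) ≤ 1 := by
    intro r hr hr1 a
    rw [Real.sqrt_le_one]
    rw [← hr1]
    exact Finset.single_le_sum (fun b _ => (hr b).le) (Finset.mem_univ a)
  have hqf : dist q (relFreq x) ≤ ε / 2 := by
    rw [dist_pi_le_iff (by positivity)]
    intro a
    have ha := (Finset.single_le_sum (f := fun a => (√(relFreq x a) - √(q a)) ^ 2)
      (fun b _ => sq_nonneg _) (Finset.mem_univ a)).trans hH.le
    have ha' := abs_le_of_sq_le_sq ha (by positivity)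
    rw [Real.dist_eq]
    have e : q a - relFreq x a = -((√(relFreq x a) - √(q a)) * (√(relFreq x a) + √(q a))) := by
      have e1 := Real.sq_sqrt (hf2 a).le
      have e2 := Real.sq_sqrt (hq0 a).le
      linear_combination e1 - e2
    rw [e, abs_neg, abs_mul]
    have s1 := hle1 hf2 (sum_relFreq hx) a
    have s2 := hle1 hq0 hq1 a
    have s3 : |√(relFreq x a) + √(q a)| ≤ 2 := by
      rw [abs_of_nonneg (by positivity)]; linarith
    calc _ ≤ ε / 4 * 2 := by gcongr
      _ = ε / 2 := by ring
  calc dist q p ≤ dist q (relFreq x) + dist (relFreq x) p := dist_triangle _ _ _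
    _ < ε / 2 + ε / 2 := add_lt_add_of_le_of_lt hqf hf3
    _ = ε := by ring

end KullbackLeibler

/-! ### The likelihood equation and the smooth estimate -/

namespace ParametricModel

variable {J s : ℕ} (M : ParametricModel J s) {θ₀ : Fin s → ℝ}

theorem mem_carrier {q : Fin J → ℝ} (hq : q ∈ M.carrier) : (∀ a, 0 < q a) ∧ ∑ a, q a = 1 := by
  obtain ⟨θ, hθ, rfl⟩ := hq
  exact ⟨M.prob_pos θ hθ, M.prob_sum θ hθ⟩

variable {M}

theorem contDiffAt_prob (h : θ₀ ∈ M.Θ) : ContDiffAt ℝ ∞ M.prob θ₀ :=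
  M.smooth.contDiffAt (M.isOpen_Θ.mem_nhds h)

theorem hasFDerivAt_prob (h : θ₀ ∈ M.Θ) : HasFDerivAt M.prob (fderiv ℝ M.prob θ₀) θ₀ :=
  ((contDiffAt_prob h).differentiableAt (by simp)).hasFDerivAt

/-- The differential of the `j`-th cell probability. -/
def cellDeriv (M : ParametricModel J s) (j : Fin J) (θ : Fin s → ℝ) : (Fin s → ℝ) →L[ℝ] ℝ :=
  (ContinuousLinearMap.proj j : (Fin J → ℝ) →L[ℝ] ℝ) ∘L fderiv ℝ M.prob θ

theorem hasFDerivAt_cell (h : θ₀ ∈ M.Θ) (j : Fin J) :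
    HasFDerivAt (fun θ => M.prob θ j) (M.cellDeriv j θ₀) θ₀ :=
  (ContinuousLinearMap.proj (R := ℝ) (φ := fun _ : Fin J => ℝ) j).hasFDerivAt.comp θ₀
    (hasFDerivAt_prob h)

theorem contDiffAt_cellDeriv (h : θ₀ ∈ M.Θ) (j : Fin J) : ContDiffAt ℝ ∞ (M.cellDeriv j) θ₀ :=
  contDiffAt_const.clm_comp ((contDiffAt_prob h).fderiv_right (by simp))

theorem sum_cellDeriv (h : θ₀ ∈ M.Θ) : ∑ j, M.cellDeriv j θ₀ = 0 := by
  have h1 : HasFDerivAt (fun θ => ∑ j, M.prob θ j) (∑ j, M.cellDeriv j θ₀) θ₀ :=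
    HasFDerivAt.fun_sum fun j _ => hasFDerivAt_cell h j
  have h2 : HasFDerivAt (fun θ => ∑ j, M.prob θ j) (0 : (Fin s → ℝ) →L[ℝ] ℝ) θ₀ := by
    refine (hasFDerivAt_const (1 : ℝ) θ₀).congr_of_eventuallyEq ?_
    filter_upwards [M.isOpen_Θ.mem_nhds h] with θ hθ
    exact M.prob_sum θ hθ
  exact h1.unique h2

/-- Near the true parameter, the closure of the model consists of points of the model with
parameters near the true one. -/
theorem exists_param_of_mem_closure (h : θ₀ ∈ M.Θ) {W : Set (Fin s → ℝ)} (hW : W ∈ 𝓝 θ₀) :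
    ∃ ε > 0, ∀ q ∈ closure M.carrier, dist q (M.prob θ₀) < ε → ∃ θ ∈ W ∩ M.Θ, M.prob θ = q := by
  -- The embedding property keeps points of the model whose parameters lie outside K away from
  -- `M.prob θ₀`. The image of the compact K is closed, so limits of nearby model points still have
  -- parameters in K.
  obtain ⟨K, hK, hKW, hKc⟩ := local_compact_nhds (Filter.inter_mem hW (M.isOpen_Θ.mem_nhds h))
  have h1 : (Subtype.val ⁻¹' K : Set M.Θ) ∈ 𝓝 (⟨θ₀, h⟩ : M.Θ) :=
    continuous_subtype_val.continuousAt.preimage_mem_nhds hK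
  rw [M.embedding.nhds_eq_comap] at h1
  obtain ⟨U, hU, hUK⟩ := h1
  obtain ⟨ε, hε, hεU⟩ := Metric.mem_nhds_iff.1 hU
  refine ⟨ε, hε, fun q hq hd => ?_⟩
  have hKi : IsClosed (M.prob '' K) :=
    (hKc.image_of_continuousOn (M.smooth.continuousOn.mono fun θ hθ => (hKW hθ).2)).isClosed
  have hsub : Metric.ball (M.prob θ₀) ε ∩ M.carrier ⊆ M.prob '' K := by
    rintro _ ⟨hb, θ, hθ, rfl⟩
    exact ⟨θ, @hUK ⟨θ, hθ⟩ (hεU hb), rfl⟩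
  have hq' : q ∈ closure (Metric.ball (M.prob θ₀) ε ∩ M.carrier) :=
    Metric.isOpen_ball.inter_closure ⟨hd, hq⟩
  obtain ⟨θ, hθ, rfl⟩ := closure_minimal hsub hKi hq'
  exact ⟨θ, hKW hθ, rfl⟩

/-- The score, in the form `∑ j, (f j - p j θ) / p j θ • D p j θ`. -/
def score (M : ParametricModel J s) (u : (Fin J → ℝ) × (Fin s → ℝ)) : (Fin s → ℝ) →L[ℝ] ℝ :=
  ∑ j, (u.1 j - M.prob u.2 j) • (M.prob u.2 j)⁻¹ • M.cellDeriv j u.2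

theorem score_prob (θ : Fin s → ℝ) : M.score (M.prob θ, θ) = 0 := by simp [score]

theorem contDiffAt_cell_snd (h : θ₀ ∈ M.Θ) (f : Fin J → ℝ) (j : Fin J) :
    ContDiffAt ℝ ∞ (fun u : (Fin J → ℝ) × (Fin s → ℝ) => M.prob u.2 j) (f, θ₀) := by
  have := (contDiffAt_pi.1 (contDiffAt_prob h)) j
  exact ContDiffAt.comp (f, θ₀) (g := fun θ => M.prob θ j) (f := Prod.snd) this contDiffAt_snd

theorem contDiffAt_weight (h : θ₀ ∈ M.Θ) (f : Fin J → ℝ) (j : Fin J) :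
    ContDiffAt ℝ ∞ (fun u : (Fin J → ℝ) × (Fin s → ℝ) => (M.prob u.2 j)⁻¹ • M.cellDeriv j u.2)
      (f, θ₀) :=
  ((contDiffAt_cell_snd h f j).inv (M.prob_pos θ₀ h j).ne').smul
    (ContDiffAt.comp (f, θ₀) (g := M.cellDeriv j) (f := Prod.snd)
      (contDiffAt_cellDeriv h j) contDiffAt_snd)

theorem contDiffAt_score (h : θ₀ ∈ M.Θ) (f : Fin J → ℝ) : ContDiffAt ℝ ∞ M.score (f, θ₀) := by
  refine ContDiffAt.sum fun j _ => ContDiffAt.fun_smul ?_ (contDiffAt_weight h f j)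
  exact ContDiffAt.sub (by fun_prop) (contDiffAt_cell_snd h f j)

/-- The derivative of the score at the true parameter. -/
theorem fderiv_score_apply (h : θ₀ ∈ M.Θ) (v : Fin J → ℝ) (t : Fin s → ℝ) :
    fderiv ℝ M.score (M.prob θ₀, θ₀) (v, t) =
      ∑ j, ((v j - M.cellDeriv j θ₀ t) / M.prob θ₀ j) • M.cellDeriv j θ₀ := by
  have h1 : ∀ j : Fin J, HasFDerivAt (fun u : (Fin J → ℝ) × (Fin s → ℝ) => u.1 j - M.prob u.2 j)
      ((ContinuousLinearMap.proj (R := ℝ) (φ := fun _ : Fin J => ℝ) j) ∘L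
        ContinuousLinearMap.fst ℝ _ _ - M.cellDeriv j θ₀ ∘L ContinuousLinearMap.snd ℝ _ _)
      (M.prob θ₀, θ₀) := by
    intro j
    refine HasFDerivAt.sub ?_ ?_
    · exact ((ContinuousLinearMap.proj (R := ℝ) (φ := fun _ : Fin J => ℝ) j) ∘L
        ContinuousLinearMap.fst ℝ (Fin J → ℝ) (Fin s → ℝ)).hasFDerivAt
    · exact HasFDerivAt.comp (M.prob θ₀, θ₀) (g := fun θ => M.prob θ j) (f := Prod.snd)
        (hasFDerivAt_cell h j) hasFDerivAt_snd
  have h2 := HasFDerivAt.fun_sum (u := univ) fun (j : Fin J) _ => (h1 j).smul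
    (((contDiffAt_weight h (M.prob θ₀) j).differentiableAt (by simp)).hasFDerivAt)
  have h3 : fderiv ℝ M.score (M.prob θ₀, θ₀) = _ := HasFDerivAt.fderiv h2
  rw [h3]
  -- The derivative of the weight drops out of the product rule, since it is multiplied by `M.prob
  -- θ₀ j - M.prob θ₀ j`.
  simp [div_eq_mul_inv, mul_smul]

/-- Definiteness of the Fisher information form: a sum of nonnegative terms vanishes only termwise,
and the differential is injective. -/
theorem sum_sq_cellDeriv_eq_zero (h : θ₀ ∈ M.Θ) {t : Fin s → ℝ}
    (ht : ∑ j, M.cellDeriv j θ₀ t ^ 2 / M.prob θ₀ j = 0) : t = 0 := by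
  have hp := M.prob_pos θ₀ h
  rw [Finset.sum_eq_zero_iff_of_nonneg fun j _ => by have := hp j; positivity] at ht
  refine M.immersion θ₀ h ?_
  rw [map_zero]
  ext j
  have := ht j (Finset.mem_univ j)
  rw [div_eq_zero_iff, or_iff_left (hp j).ne', sq_eq_zero_iff] at this
  exact this

/-- Evaluated at (t, t), this partial derivative is minus the Fisher information form, so it is
injective. Source and dual have the same dimension. -/
theorem isInvertible_fderiv_score (h : θ₀ ∈ M.Θ) :
    (fderiv ℝ M.score (M.prob θ₀, θ₀) ∘L
      ContinuousLinearMap.inr ℝ (Fin J → ℝ) (Fin s → ℝ)).IsInvertible := by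
  set F := fderiv ℝ M.score (M.prob θ₀, θ₀) ∘L ContinuousLinearMap.inr ℝ (Fin J → ℝ) (Fin s → ℝ)
    with hF
  have hinj : Function.Injective F := by
    rw [injective_iff_map_eq_zero]
    intro t ht
    have h1 : F t t = 0 := by rw [ht]; rfl
    rw [hF, ContinuousLinearMap.comp_apply, ContinuousLinearMap.inr_apply,
      fderiv_score_apply h] at h1
    refine sum_sq_cellDeriv_eq_zero h (neg_eq_zero.1 (Eq.trans ?_ h1))
    rw [← Finset.sum_neg_distrib]
    simp only [_root_.sum_apply]
    refine Finset.sum_congr rfl fun j _ => ?_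
    simp
    ring
  have hrank : Module.finrank ℝ (Fin s → ℝ) = Module.finrank ℝ ((Fin s → ℝ) →L[ℝ] ℝ) := by
    rw [← (LinearMap.toContinuousLinearMap (𝕜 := ℝ) (E := Fin s → ℝ) (F' := ℝ)).finrank_eq]
    exact Subspace.dual_finrank_eq.symm
  refine ⟨(LinearEquiv.ofInjectiveOfFinrankEq (F : (Fin s → ℝ) →ₗ[ℝ] _) hinj
    hrank).toContinuousLinearEquiv, ?_⟩
  ext1 t
  have e := LinearEquiv.coe_ofInjectiveOfFinrankEq (F : (Fin s → ℝ) →ₗ[ℝ] _) hinj hrank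
  exact LinearMap.congr_fun e t

/-- The likelihood equation. -/
theorem score_eq_zero_of_isMaxLik {θ : Fin s → ℝ} (hθ : θ ∈ M.Θ) {x : Fin J → ℕ}
    (hx : ∑ a, x a ≠ 0) (h : IsMaxLik M.carrier x (M.prob θ)) : M.score (relFreq x, θ) = 0 := by
  have hmax : IsLocalMax (fun θ => ∑ j, (x j : ℝ) * Real.log (M.prob θ j)) θ := by
    filter_upwards [M.isOpen_Θ.mem_nhds hθ] with θ' hθ'
    exact (log_multinomialProb_le_iff (M.prob_pos _ hθ') (M.prob_pos _ hθ)).1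
      (h.2 _ ⟨θ', hθ', rfl⟩)
  have hd : HasFDerivAt (fun θ => ∑ j, (x j : ℝ) * Real.log (M.prob θ j))
      (∑ j, (x j : ℝ) • (M.prob θ j)⁻¹ • M.cellDeriv j θ) θ :=
    HasFDerivAt.fun_sum fun j _ =>
      ((hasFDerivAt_cell hθ j).log (M.prob_pos θ hθ j).ne').const_mul _
  have h0 := hmax.hasFDerivAt_eq_zero hd
  have hN : ((∑ b, x b : ℕ) : ℝ) ≠ 0 := by exact_mod_cast hx
  -- Centring the score costs only `∑ j, M.cellDeriv j θ`, which is zero because the probabilities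
  -- sum to 1.
  have : M.score (relFreq x, θ) = ((∑ b, x b : ℕ) : ℝ)⁻¹ •
      (∑ j, (x j : ℝ) • (M.prob θ j)⁻¹ • M.cellDeriv j θ) - ∑ j, M.cellDeriv j θ := by
    rw [score, Finset.smul_sum, ← Finset.sum_sub_distrib]
    refine Finset.sum_congr rfl fun j _ => ?_
    have := (M.prob_pos θ hθ j).ne'
    dsimp only
    ext1 t
    simp only [_root_.smul_apply, _root_.sub_apply, smul_eq_mul, relFreq]
    field_simp
  rw [this, h0, sum_cellDeriv hθ, smul_zero, sub_zero]

/-- Near the true parameter, the maximum likelihood estimate is a smooth function of the relative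
frequencies. -/
theorem exists_smooth_estimate (h : θ₀ ∈ M.Θ) :
    ∃ (g : (Fin J → ℝ) → Fin s → ℝ) (G : (Fin J → ℝ) →L[ℝ] (Fin s → ℝ)),
      g (M.prob θ₀) = θ₀ ∧ ContDiffAt ℝ ∞ g (M.prob θ₀) ∧ HasFDerivAt g G (M.prob θ₀) ∧
      (∀ v, ∑ j, ((v j - M.cellDeriv j θ₀ (G v)) / M.prob θ₀ j) • M.cellDeriv j θ₀ = 0) ∧
      ∀ᶠ f in 𝓝 (M.prob θ₀), ∀ x q, relFreq x = f → ∑ a, x a ≠ 0 → IsMaxLik M.carrier x q →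
        q = M.prob (g f) := by
  have cd := contDiffAt_score h (M.prob θ₀)
  have inv := isInvertible_fderiv_score h
  have hne : (∞ : WithTop ℕ∞) ≠ 0 := by simp
  refine ⟨cd.implicitFunction hne inv, _, cd.implicitFunction_apply_self hne inv,
    cd.contDiffAt_implicitFunction hne inv,
    (cd.hasStrictFDerivAt_implicitFunction hne inv).hasFDerivAt, fun v => ?_, ?_⟩
  -- The differentiated likelihood equation: v minus its image in the tangent space is
  -- Fisher-orthogonal to the tangent space.
  · rw [← fderiv_score_apply h]
    set D := fderiv ℝ M.score (M.prob θ₀, θ₀)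
    have e : ∀ t : Fin s → ℝ, D (v, t) = (D ∘L ContinuousLinearMap.inl ℝ _ _) v +
        (D ∘L ContinuousLinearMap.inr ℝ _ _) t := by
      intro t
      simp [← map_add]
    rw [e]
    have e' := inv.self_apply_inverse ((D ∘L ContinuousLinearMap.inl ℝ _ _) v)
    rw [_root_.neg_apply, map_neg, ContinuousLinearMap.comp_apply _ (D ∘L _), e', add_neg_cancel]
  -- Consistency places the maximizer at a parameter near `θ₀`; there it solves the likelihood
  -- equation, whose local solution is unique.
  · have hev := cd.eventually_apply_eq_iff_implicitFunction hne inv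
    rw [nhds_prod_eq, Filter.eventually_prod_iff] at hev
    obtain ⟨pa, hpa, pb, hpb, hab⟩ := hev
    obtain ⟨ε, hε, hεW⟩ := exists_param_of_mem_closure h hpb
    have hcons := eventually_dist_lt_of_isMaxLik (fun r => M.mem_carrier)
      (p := M.prob θ₀) ⟨θ₀, h, rfl⟩ hε
    filter_upwards [hpa, hcons] with f hf hf'
    intro x q hxf hx hq
    obtain ⟨θ, ⟨hθW, hθ⟩, rfl⟩ := hεW q hq.1 (hf' x q hxf hx hq)
    have hs := score_eq_zero_of_isMaxLik hθ hx hq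
    rw [hxf] at hs
    have := (hab hf hθW).1 (by rw [hs, score_prob])
    rw [this]

end ParametricModel

open scoped Nat

/-! ### Taylor approximation with a uniform remainder bound -/

section Taylor

variable {E : Type*} [NormedAddCommGroup E] [NormedSpace ℝ E]

/-- The integral form of the remainder, with the derivative of order n + 1 bounded near p by
continuity. -/
theorem exists_taylor_bound {h : E → ℝ} {p : E} (n : ℕ) (hh : ContDiffAt ℝ (n + 1) h p) :
    ∃ C, ∃ δ > 0, ∀ v, ‖v‖ < δ →
      |h (p + v) - ∑ k ∈ Finset.range (n + 1), ((k ! : ℕ) : ℝ)⁻¹ *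
        iteratedFDeriv ℝ k h p (fun _ => v)| ≤ C * ‖v‖ ^ (n + 1) := by
  have h1 : ∀ᶠ x in 𝓝 p, ContDiffAt ℝ (n + 1) h x := hh.eventually (by simp)
  have h2 : ∀ᶠ x in 𝓝 p, ‖iteratedFDeriv ℝ (n + 1) h x‖ < ‖iteratedFDeriv ℝ (n + 1) h p‖ + 1 := by
    have : ContinuousAt (iteratedFDeriv ℝ (n + 1) h) p :=
      (hh.iteratedFDeriv_right (i := n + 1) (m := 0) (by simp)).continuousAt
    exact this.norm.eventually_lt_const (by linarith)
  obtain ⟨δ, hδ, hb⟩ := Metric.eventually_nhds_iff.1 (h1.and h2)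
  refine ⟨((n ! : ℕ) : ℝ)⁻¹ * (‖iteratedFDeriv ℝ (n + 1) h p‖ + 1), δ, hδ, fun v hv => ?_⟩
  have hseg : ∀ t ∈ Set.Icc (0 : ℝ) 1, dist (p + t • v) p < δ := by
    intro t ht
    rw [dist_self_add_left, norm_smul, Real.norm_of_nonneg ht.1]
    exact (mul_le_of_le_one_left (norm_nonneg v) ht.2).trans_lt hv
  have := map_add_eq_sum_add_integral_iteratedFDeriv (f := h) (x := p) (y := v) (n := n)
    fun t ht => (hb (hseg t ht)).1
  rw [this]
  simp only [smul_eq_mul, add_sub_cancel_left]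
  rw [abs_mul, abs_of_nonneg (by positivity), mul_assoc]
  gcongr
  rw [← Real.norm_eq_abs]
  refine (intervalIntegral.norm_integral_le_of_norm_le_const
    (C := (‖iteratedFDeriv ℝ (n + 1) h p‖ + 1) * ‖v‖ ^ (n + 1)) fun t ht => ?_).trans (by simp)
  rw [Set.uIoc_of_le zero_le_one] at ht
  have ht' : t ∈ Set.Icc (0 : ℝ) 1 := ⟨ht.1.le, ht.2⟩
  rw [norm_mul, Real.norm_eq_abs, abs_of_nonneg (pow_nonneg (by linarith [ht.2]) _)]
  have e1 : (1 - t) ^ n ≤ 1 := pow_le_one₀ (by linarith [ht.2]) (by linarith [ht.1])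
  have e2 := ContinuousMultilinearMap.le_opNorm (iteratedFDeriv ℝ (n + 1) h (p + t • v))
    (fun _ => v)
  simp only [Finset.prod_const, Finset.card_univ, Fintype.card_fin] at e2
  calc _ ≤ 1 * (‖iteratedFDeriv ℝ (n + 1) h (p + t • v)‖ * ‖v‖ ^ (n + 1)) := by gcongr
    _ ≤ _ := by
      rw [one_mul]
      have := (hb (hseg t ht')).2.le
      gcongr

end Taylor

/-! ### Norm and boundedness estimates -/

section Norm

variable {α : Type*} [Fintype α]

theorem norm_pow_le_sum_abs_pow (v : α → ℝ) {k : ℕ} (hk : k ≠ 0) : ‖v‖ ^ k ≤ ∑ a, |v a| ^ k := by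
  cases isEmpty_or_nonempty α with
  | inl h => simp [Subsingleton.elim v 0, hk]
  | inr h =>
    obtain ⟨b, -, hb⟩ := Finset.exists_max_image univ (fun a => |v a|) Finset.univ_nonempty
    have : ‖v‖ ≤ |v b| := (pi_norm_le_iff_of_nonneg (abs_nonneg _)).2 fun a => hb a (mem_univ a)
    calc ‖v‖ ^ k ≤ |v b| ^ k := by gcongr
      _ ≤ _ := Finset.single_le_sum (f := fun a => |v a| ^ k) (fun a _ => by positivity) (mem_univ b)

theorem relFreq_le_one (x : α → ℕ) (a : α) : relFreq x a ≤ 1 := by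
  refine div_le_one_of_le₀ ?_ (Nat.cast_nonneg _)
  exact_mod_cast Finset.single_le_sum (f := x) (fun _ _ => Nat.zero_le _) (mem_univ a)

theorem norm_deviation_le_one {p : α → ℝ} (hp : ∀ a, 0 ≤ p a) (hp1 : ∑ a, p a = 1) (x : α → ℕ) :
    ‖deviation p x‖ ≤ 1 := by
  refine (pi_norm_le_iff_of_nonneg zero_le_one).2 fun a => ?_
  rw [deviation_eq, Pi.sub_apply, Real.norm_eq_abs, abs_le]
  have h1 : p a ≤ 1 := by
    rw [← hp1]; exact Finset.single_le_sum (fun b _ => hp b) (mem_univ a)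
  constructor <;> linarith [hp a, relFreq_le_one x a, relFreq_nonneg x a]

/-- Continuity up to the boundary, due to 0 log 0 = 0, together with compactness of the unit cube.
This controls the loss on samples far from the truth. -/
theorem exists_abs_klDivergence_le {p : α → ℝ} (hp : ∀ a, 0 < p a) :
    ∃ K, ∀ q : α → ℝ, (∀ a, 0 ≤ q a) → ∑ a, q a = 1 → |klDivergence q p| ≤ K := by
  have hc : IsCompact (Set.Icc (0 : α → ℝ) 1) := isCompact_Icc
  obtain ⟨K, hK⟩ := hc.exists_bound_of_continuousOn (continuous_klDivergence hp).continuousOn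
  refine ⟨K, fun q hq hq1 => hK q ⟨fun a => hq a, fun a => ?_⟩⟩
  simp only [Pi.one_apply]
  rw [← hq1]
  exact Finset.single_le_sum (fun b _ => hq b) (mem_univ a)

end Norm

/-! ### Polynomial approximation of the loss and the trace identity -/

namespace ParametricModel

variable {J s : ℕ} {M : ParametricModel J s} {θ₀ : Fin s → ℝ}

theorem contDiffAt_klDivergence {α : Type*} [Fintype α] {p : α → ℝ} (hp : ∀ a, 0 < p a) :
    ContDiffAt ℝ ∞ (fun q => klDivergence q p) p := by
  unfold klDivergence
  refine ContDiffAt.sum fun a _ => ContDiffAt.mul (by fun_prop) (ContDiffAt.log ?_ ?_)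
  · exact ContDiffAt.div_const (by fun_prop) _
  · rw [div_self (hp a).ne']; exact one_ne_zero

/-- The risk of the maximum likelihood estimate as a function of the relative frequencies agrees
with a polynomial of degree four in the deviation, up to an error of fifth order. -/
theorem exists_polynomial_approx (h : θ₀ ∈ M.Θ) {g : (Fin J → ℝ) → Fin s → ℝ}
    (hg0 : g (M.prob θ₀) = θ₀) (hg : ContDiffAt ℝ ∞ g (M.prob θ₀))
    (hest : ∀ᶠ f in 𝓝 (M.prob θ₀), ∀ x q, relFreq x = f → ∑ a, x a ≠ 0 →
      IsMaxLik M.carrier x q → q = M.prob (g f)) :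
    ∃ (T : (k : ℕ) → ContinuousMultilinearMap ℝ (fun _ : Fin (k + 1) => Fin J → ℝ) ℝ) (C : ℝ),
      ((fun v => klDivergence (M.prob (g (M.prob θ₀ + v))) (M.prob θ₀) -
        ∑ k ∈ Finset.range 4, T k fun _ => v) =O[𝓝 0] fun v => ‖v‖ ^ 5) ∧
      ∀ x q, ∑ a, x a ≠ 0 → IsMaxLik M.carrier x q →
        |klDivergence q (M.prob θ₀) - ∑ k ∈ Finset.range 4, T k fun _ => deviation (M.prob θ₀) x| ≤
          C * ‖deviation (M.prob θ₀) x‖ ^ 5 := by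
  set p := M.prob θ₀ with hpdef
  have hp := M.prob_pos θ₀ h
  have hp1 := M.prob_sum θ₀ h
  set H : (Fin J → ℝ) → ℝ := fun f => klDivergence (M.prob (g f)) p with hH
  have hH0 : H p = 0 := by simp only [hH, hg0, ← hpdef]; exact klDivergence_self
  have hHc : ContDiffAt ℝ ∞ H p := by
    have h1 : ContDiffAt ℝ ∞ M.prob (g p) := by rw [hg0]; exact contDiffAt_prob h
    have h2 : ContDiffAt ℝ ∞ (fun q => klDivergence q p) (M.prob (g p)) := by
      rw [hg0]; exact contDiffAt_klDivergence hp
    exact ContDiffAt.comp p (g := fun q => klDivergence q p) (f := fun f => M.prob (g f)) h2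
      (ContDiffAt.comp p h1 hg)
  obtain ⟨C₁, δ₁, hδ₁, hT⟩ := exists_taylor_bound 4
    (by exact_mod_cast contDiffAt_infty.1 hHc (4 + 1))
  -- Indices are shifted so that `T k` has degree k + 1; the constant Taylor term is `H p = 0`.
  set T : (k : ℕ) → ContinuousMultilinearMap ℝ (fun _ : Fin (k + 1) => Fin J → ℝ) ℝ :=
    fun k => (((k + 1)! : ℕ) : ℝ)⁻¹ • iteratedFDeriv ℝ (k + 1) H p with hTdef
  have hT' : ∀ v, ‖v‖ < δ₁ → |H (p + v) - ∑ k ∈ Finset.range 4, T k fun _ => v| ≤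
      C₁ * ‖v‖ ^ 5 := by
    intro v hv
    have := hT v hv
    rw [Finset.sum_range_succ'] at this
    simpa [hTdef, hH0] using this
  refine ⟨T, ?_⟩
  obtain ⟨δ₂, hδ₂, hest⟩ := Metric.eventually_nhds_iff.1 hest
  obtain ⟨K, hK⟩ := exists_abs_klDivergence_le hp
  set B := ∑ k ∈ Finset.range 4, ‖T k‖ with hB
  set δ := min δ₁ δ₂ with hδdef
  have hδ : 0 < δ := lt_min hδ₁ hδ₂
  have hK0 : 0 ≤ K := (abs_nonneg _).trans (hK p (fun a => (hp a).le) hp1)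
  have hB0 : 0 ≤ B := Finset.sum_nonneg fun _ _ => norm_nonneg _
  refine ⟨max C₁ ((K + B) / δ ^ 5), ?_, fun x q hx hq => ?_⟩
  · refine IsBigO.of_bound C₁ ?_
    filter_upwards [Metric.ball_mem_nhds 0 hδ₁] with v hv
    rw [Real.norm_eq_abs, norm_pow, norm_norm]
    exact hT' v (by simpa using hv)
  · set v := deviation p x with hv
    have hpv : p + v = relFreq x := by rw [hv, deviation_eq]; abel
    rcases lt_or_ge ‖v‖ δ with hlt | hge
    · have hqe : q = M.prob (g (relFreq x)) := by
        refine hest ?_ x q rfl hx hq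
        rw [dist_eq_norm, ← deviation_eq]
        exact hlt.trans_le (min_le_right _ _)
      rw [hqe, ← hpv]
      refine (hT' v (hlt.trans_le (min_le_left _ _))).trans ?_
      gcongr
      exact le_max_left _ _
    -- Far from the truth both loss and polynomial are bounded, and ‖v‖ ≥ δ turns that bound into a
    -- multiple of ‖v‖⁵. No tail probabilities are needed.
    · have hv1 : ‖v‖ ≤ 1 := norm_deviation_le_one (fun a => (hp a).le) hp1 x
      have hq' := closure_subset_simplex (fun r => M.mem_carrier) hq.1
      have hP : |∑ k ∈ Finset.range 4, T k fun _ => v| ≤ B := by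
        refine (Finset.abs_sum_le_sum_abs _ _).trans (Finset.sum_le_sum fun k _ => ?_)
        have := (T k).le_opNorm fun _ => v
        simp only [Finset.prod_const, Finset.card_univ, Fintype.card_fin] at this
        refine this.trans (mul_le_of_le_one_right (norm_nonneg _) (pow_le_one₀ (norm_nonneg _) hv1))
      calc _ ≤ |klDivergence q p| + |∑ k ∈ Finset.range 4, T k fun _ => v| := abs_sub _ _
        _ ≤ K + B := add_le_add (hK q hq'.1 hq'.2) hP
        _ = (K + B) / δ ^ 5 * δ ^ 5 := by field_simp
        _ ≤ max C₁ ((K + B) / δ ^ 5) * ‖v‖ ^ 5 := by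
          gcongr
          exact le_max_right _ _

/-- The trace identity that gives the first-order risk `s / 2`. -/
theorem sum_sq_fisher_projection (h : θ₀ ∈ M.Θ) {G : (Fin J → ℝ) →L[ℝ] (Fin s → ℝ)}
    (hG : ∀ v, ∑ j, ((v j - M.cellDeriv j θ₀ (G v)) / M.prob θ₀ j) • M.cellDeriv j θ₀ = 0) :
    ∑ a, (M.prob θ₀ a)⁻¹ * ∑ b, M.prob θ₀ b *
      M.cellDeriv a θ₀ (G (Pi.single b 1 - M.prob θ₀)) ^ 2 = s := by
  set p := M.prob θ₀ with hpdef
  have hp := M.prob_pos θ₀ h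
  have hp' : ∀ j, p j ≠ 0 := fun j => (hp j).ne'
  have hG' : ∀ v t, ∑ j, (v j - M.cellDeriv j θ₀ (G v)) / p j * M.cellDeriv j θ₀ t = 0 := by
    intro v t
    have := congrArg (fun L : (Fin s → ℝ) →L[ℝ] ℝ => L t) (hG v)
    simpa using this
  have hsum0 : ∀ t, ∑ j, M.cellDeriv j θ₀ t = 0 := by
    intro t
    have := congrArg (fun L : (Fin s → ℝ) →L[ℝ] ℝ => L t) (sum_cellDeriv h)
    simpa using this
  -- Fisher weights 1/p make p itself orthogonal to the tangent space, whose vectors have coordinate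
  -- sum zero.
  have hGp : G p = 0 := by
    refine sum_sq_cellDeriv_eq_zero h ?_
    have h1 := hG' p (G p)
    have h2 : ∑ j, (p j - M.cellDeriv j θ₀ (G p)) / p j * M.cellDeriv j θ₀ (G p) =
        ∑ j, M.cellDeriv j θ₀ (G p) - ∑ j, M.cellDeriv j θ₀ (G p) ^ 2 / p j := by
      rw [← Finset.sum_sub_distrib]
      refine Finset.sum_congr rfl fun j _ => ?_
      have := hp' j
      field_simp
    rw [h1, hsum0] at h2
    linarith
  -- G is a left inverse of the differential, so the composite of G with the differential is a
  -- projection.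
  have hGB : ∀ t, G (fderiv ℝ M.prob θ₀ t) = t := by
    intro t
    have := hG' (fderiv ℝ M.prob θ₀ t) (t - G (fderiv ℝ M.prob θ₀ t))
    refine (sub_eq_zero.1 (sum_sq_cellDeriv_eq_zero h (Eq.trans ?_ this))).symm
    refine Finset.sum_congr rfl fun j _ => ?_
    have e : fderiv ℝ M.prob θ₀ t j = M.cellDeriv j θ₀ t := rfl
    rw [e, ← map_sub]
    ring
  -- The squared Fisher norm of a projected basis vector equals its Fisher product with that basis
  -- vector. Hence the double sum collapses to the diagonal, that is, to a trace.
  have hdiag : ∀ b, ∑ a, M.cellDeriv a θ₀ (G (Pi.single b 1)) ^ 2 / p a =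
      M.cellDeriv b θ₀ (G (Pi.single b 1)) / p b := by
    intro b
    have h1 := hG' (Pi.single b 1) (G (Pi.single b 1))
    have h2 : ∑ j, ((Pi.single b 1 : Fin J → ℝ) j - M.cellDeriv j θ₀ (G (Pi.single b 1))) / p j *
        M.cellDeriv j θ₀ (G (Pi.single b 1)) =
        ∑ j, (Pi.single b 1 : Fin J → ℝ) j * (M.cellDeriv j θ₀ (G (Pi.single b 1)) / p j) -
          ∑ j, M.cellDeriv j θ₀ (G (Pi.single b 1)) ^ 2 / p j := by
      rw [← Finset.sum_sub_distrib]
      refine Finset.sum_congr rfl fun j _ => ?_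
      ring
    rw [h1] at h2
    simp only [Pi.single_apply, ite_mul, one_mul, zero_mul, Finset.sum_ite_eq', Finset.mem_univ,
      if_true] at h2
    linarith
  calc _ = ∑ a, ∑ b, p b * (M.cellDeriv a θ₀ (G (Pi.single b 1)) ^ 2 / p a) := by
        refine Finset.sum_congr rfl fun a _ => ?_
        rw [Finset.mul_sum]
        refine Finset.sum_congr rfl fun b _ => ?_
        rw [map_sub, hGp, sub_zero]
        ring
    _ = ∑ b, M.cellDeriv b θ₀ (G (Pi.single b 1)) := by
        rw [Finset.sum_comm]
        refine Finset.sum_congr rfl fun b _ => ?_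
        rw [← Finset.mul_sum, hdiag b]
        have := hp' b
        field_simp
    _ = LinearMap.trace ℝ (Fin J → ℝ) ((fderiv ℝ M.prob θ₀ : (Fin s → ℝ) →ₗ[ℝ] (Fin J → ℝ)) ∘ₗ
          (G : (Fin J → ℝ) →ₗ[ℝ] (Fin s → ℝ))) := by
        rw [LinearMap.trace_eq_matrix_trace ℝ (Pi.basisFun ℝ (Fin J)), Matrix.trace]
        refine Finset.sum_congr rfl fun b _ => ?_
        rw [Matrix.diag_apply, LinearMap.toMatrix_apply]
        simp [cellDeriv]
    -- By cyclicity the trace moves to the parameter space, where the composite is the identity.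
    _ = LinearMap.trace ℝ (Fin s → ℝ) LinearMap.id := by
        rw [LinearMap.trace_comp_comm']
        congr 1
        exact LinearMap.ext fun t => hGB t
    _ = s := by simp

end ParametricModel

/-! ### Quadratic approximation of the loss and the envelope of all estimators -/

theorem abs_log_one_add_sub_le_two {t : ℝ} (ht : |t| ≤ 1 / 2) :
    |Real.log (1 + t) - (t - t ^ 2 / 2)| ≤ 2 * |t| ^ 3 := by
  have h := Real.abs_log_sub_add_sum_range_le (x := -t) (by rw [abs_neg]; linarith) 2
  simp only [Finset.sum_range_succ, Finset.sum_range_zero, abs_neg, sub_neg_eq_add] at h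
  push_cast at h
  have e : |Real.log (1 + t) - (t - t ^ 2 / 2)| =
      |0 + (-t) ^ (0 + 1) / (0 + 1) + (-t) ^ (1 + 1) / (1 + 1) + Real.log (1 + t)| := by
    congr 1; ring
  rw [e]
  refine h.trans ?_
  rw [div_le_iff₀ (by linarith)]
  have : 0 ≤ |t| ^ 3 := by positivity
  nlinarith

/-- Second-order expansion of the Kullback--Leibler divergence at `p`. -/
theorem klDivergence_sub_isLittleO {α : Type*} [Fintype α] {p : α → ℝ} (hp : ∀ a, 0 < p a)
    {β : Type*} {l : Filter β} {w : β → α → ℝ} (hw : Tendsto w l (𝓝 0))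
    (hw0 : ∀ᶠ v in l, ∑ a, w v a = 0) :
    (fun v => klDivergence (p + w v) p - ∑ a, (2 * p a)⁻¹ * w v a ^ 2) =o[l]
      fun v => ‖w v‖ ^ 2 := by
  -- The linear term is subtracted in each cell, as it cancels only in the sum over cells.
  have hterm : ∀ a, (fun v => (p a + w v a) * Real.log ((p a + w v a) / p a) - w v a -
      (2 * p a)⁻¹ * w v a ^ 2) =o[l] fun v => ‖w v‖ ^ 2 := by
    intro a
    have hpa := hp a
    have hwa : Tendsto (fun v => w v a) l (𝓝 0) := by
      have := (tendsto_pi_nhds.1 hw) a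
      simpa using this
    have hO : (fun v => (p a + w v a) * Real.log ((p a + w v a) / p a) - w v a -
        (2 * p a)⁻¹ * w v a ^ 2) =O[l] fun v => (w v a) ^ 3 := by
      refine IsBigO.of_bound (4 * p a * (p a ^ 3)⁻¹) ?_
      have hsmall : ∀ᶠ v in l, |w v a| < p a / 2 := by
        have := hwa.abs
        rw [abs_zero] at this
        exact this.eventually_lt_const (by positivity)
      filter_upwards [hsmall] with v hv
      set t := w v a / p a with ht
      have hwt : w v a = p a * t := by rw [ht]; field_simp
      have htb : |t| ≤ 1 / 2 := by
        rw [ht, abs_div, abs_of_pos hpa, div_le_iff₀ hpa]; linarith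
      have hlog := abs_log_one_add_sub_le_two htb
      have e : (p a + w v a) * Real.log ((p a + w v a) / p a) - w v a -
          (2 * p a)⁻¹ * w v a ^ 2 =
          p a * ((1 + t) * (Real.log (1 + t) - (t - t ^ 2 / 2)) - t ^ 3 / 2) := by
        rw [hwt, show (p a + p a * t) / p a = 1 + t by field_simp]
        field_simp
        ring
      rw [e, Real.norm_eq_abs, Real.norm_eq_abs, abs_mul, abs_of_pos hpa, hwt, abs_pow, abs_mul,
        abs_of_pos hpa, mul_pow]
      have h1 : |1 + t| ≤ 3 / 2 := (abs_add_le _ _).trans (by rw [abs_one]; linarith)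
      have h2 : |(1 + t) * (Real.log (1 + t) - (t - t ^ 2 / 2)) - t ^ 3 / 2| ≤ 4 * |t| ^ 3 := by
        refine (abs_sub _ _).trans ?_
        rw [abs_mul, abs_div, abs_pow, abs_two]
        have : |1 + t| * |Real.log (1 + t) - (t - t ^ 2 / 2)| ≤ 3 / 2 * (2 * |t| ^ 3) := by gcongr
        have : 0 ≤ |t| ^ 3 := by positivity
        linarith
      calc p a * _ ≤ p a * (4 * |t| ^ 3) := by gcongr
        _ = _ := by field_simp
    refine hO.trans_isLittleO ?_
    have h1 : (fun v => (w v a) ^ 2) =O[l] fun v => ‖w v‖ ^ 2 := by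
      refine IsBigO.of_bound 1 (Eventually.of_forall fun v => ?_)
      rw [norm_pow, norm_pow, norm_norm, one_mul]
      gcongr
      exact norm_le_pi_norm (w v) a
    have h2 : (fun v => w v a) =o[l] fun _ => (1 : ℝ) := (isLittleO_one_iff ℝ).2 hwa
    have := h1.mul_isLittleO h2
    simp only [mul_one] at this
    exact this.congr_left fun v => by ring
  have := IsLittleO.fun_sum (s := univ) fun a _ => hterm a
  refine this.congr' ?_ EventuallyEq.rfl
  filter_upwards [hw0] with v hv
  simp only [klDivergence, Pi.add_apply, Finset.sum_sub_distrib, hv, sub_zero]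

section Normed

variable {α : Type*} [Fintype α]

/-- A function that is small of second order at `0` and bounded on the unit ball. -/
theorem exists_bound_of_isLittleO_sq {F : (α → ℝ) → ℝ} (hF : F =o[𝓝 0] fun v => ‖v‖ ^ 2) {B : ℝ}
    (hB : ∀ v, ‖v‖ ≤ 1 → |F v| ≤ B) {ε : ℝ} (hε : 0 < ε) :
    ∃ C, ∀ v, ‖v‖ ≤ 1 → |F v| ≤ ε * (∑ a, v a ^ 2) + C * ∑ a, v a ^ 4 := by
  obtain ⟨δ, hδ, h⟩ := Metric.eventually_nhds_iff.1 (hF.bound hε)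
  have hB0 : 0 ≤ B := (abs_nonneg _).trans (hB 0 (by simp))
  refine ⟨B / δ ^ 4, fun v hv => ?_⟩
  have h2 := norm_pow_le_sum_abs_pow v two_ne_zero
  have h4 := norm_pow_le_sum_abs_pow v four_ne_zero
  simp only [Even.pow_abs (by decide : Even 4), sq_abs] at h2 h4
  have s2 : 0 ≤ ∑ a, v a ^ 2 := Finset.sum_nonneg fun a _ => by positivity
  have s4 : 0 ≤ ∑ a, v a ^ 4 := Finset.sum_nonneg fun a _ => by positivity
  rcases lt_or_ge ‖v‖ δ with hlt | hge
  · have := h (y := v) (by simpa using hlt)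
    rw [Real.norm_eq_abs, norm_pow, norm_norm] at this
    calc _ ≤ ε * ‖v‖ ^ 2 := this
      _ ≤ ε * ∑ a, v a ^ 2 := by gcongr
      _ ≤ _ := le_add_of_nonneg_right (by positivity)
  · calc _ ≤ B := hB v hv
      _ = B / δ ^ 4 * δ ^ 4 := by field_simp
      _ ≤ B / δ ^ 4 * ∑ a, v a ^ 4 := by
        have : δ ^ 4 ≤ ‖v‖ ^ 4 := by gcongr
        gcongr
        linarith
      _ ≤ _ := le_add_of_nonneg_left (by positivity)

end Normed

namespace ParametricModel

variable {J s : ℕ} {M : ParametricModel J s} {θ₀ : Fin s → ℝ}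

/-- The increment w of the estimated probabilities may be replaced by its linearization L in the
quadratic form, because w² - L² = (w - L)(w + L) is o(‖v‖)·O(‖v‖). The resulting quadratic form has
an expectation given by the trace identity. -/
theorem klDivergence_estimate_sub_isLittleO (h : θ₀ ∈ M.Θ) {g : (Fin J → ℝ) → Fin s → ℝ}
    {G : (Fin J → ℝ) →L[ℝ] (Fin s → ℝ)} (hg0 : g (M.prob θ₀) = θ₀)
    (hG : HasFDerivAt g G (M.prob θ₀)) :
    (fun v => klDivergence (M.prob (g (M.prob θ₀ + v))) (M.prob θ₀) -
      ∑ a, (2 * M.prob θ₀ a)⁻¹ * M.cellDeriv a θ₀ (G v) ^ 2) =o[𝓝 0] fun v => ‖v‖ ^ 2 := by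
  set p := M.prob θ₀ with hpdef
  have hp : ∀ a, 0 < p a := M.prob_pos θ₀ h
  set L := fderiv ℝ M.prob θ₀ ∘L G with hL
  set w : (Fin J → ℝ) → Fin J → ℝ := fun v => M.prob (g (p + v)) - p with hw
  have hd : HasFDerivAt (fun f => M.prob (g f)) L p :=
    HasFDerivAt.comp p (by rw [hg0]; exact hasFDerivAt_prob h) hG
  have hwL : (fun v => w v - L v) =o[𝓝 0] fun v => v := by
    have := hasFDerivAt_iff_isLittleO_nhds_zero.1 hd
    simpa only [hg0, ← hpdef] using this
  have hLO : (fun v => L v) =O[𝓝 0] fun v => v := L.isBigO_id _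
  have hwO : w =O[𝓝 0] fun v => v := by
    simpa using hwL.isBigO.add hLO
  have hw0 : Tendsto w (𝓝 0) (𝓝 0) := hwO.trans_tendsto tendsto_id
  have hsum : ∀ᶠ v in 𝓝 (0 : Fin J → ℝ), ∑ a, w v a = 0 := by
    have ht : Tendsto (fun v : Fin J → ℝ => p + v) (𝓝 0) (𝓝 p) := by
      have : Continuous fun v : Fin J → ℝ => p + v := by fun_prop
      simpa using this.tendsto 0
    have hgt : Tendsto (fun v => g (p + v)) (𝓝 0) (𝓝 θ₀) := by
      have := hG.continuousAt.tendsto.comp ht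
      rwa [hg0] at this
    filter_upwards [hgt (M.isOpen_Θ.mem_nhds h)] with v hv
    simp only [hw, Pi.sub_apply, Finset.sum_sub_distrib]
    rw [M.prob_sum _ hv, hpdef, M.prob_sum _ h, sub_self]
  have h1 := (klDivergence_sub_isLittleO hp hw0 hsum).trans_isBigO (hwO.norm_norm.pow 2)
  have h2 : (fun v => ∑ a, (2 * p a)⁻¹ * (w v a ^ 2 - L v a ^ 2)) =o[𝓝 0] fun v => ‖v‖ ^ 2 := by
    refine IsLittleO.fun_sum fun a _ => IsLittleO.const_mul_left ?_ _
    have e1 : (fun v => w v a - L v a) =o[𝓝 0] fun v => ‖v‖ :=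
      ((isLittleO_pi.1 hwL) a).norm_right
    have e2 : (fun v => w v a + L v a) =O[𝓝 0] fun v => ‖v‖ :=
      ((isBigO_pi.1 (hwO.add hLO)) a).norm_right
    have := e1.mul_isBigO e2
    refine (this.congr_left fun v => by ring).congr_right fun v => by ring
  refine (h1.add h2).congr_left fun v => ?_
  have e : p + w v = M.prob (g (p + v)) := by simp only [hw]; abel
  simp only [e, mul_sub, Finset.sum_sub_distrib]
  have : ∀ a, L v a = M.cellDeriv a θ₀ (G v) := fun a => rfl
  simp only [this]
  ring

/-- The risk of every maximum likelihood estimator is squeezed between two bounded functions of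
the data whose expectations have the same expansion of second order. -/
theorem exists_envelope (h : θ₀ ∈ M.Θ) :
    ∃ (A K : ℝ) (lo hi : (Fin J → ℕ) → ℝ), (∀ x, |lo x| ≤ K) ∧ (∀ x, |hi x| ≤ K) ∧
      (∀ x q, ∑ a, x a ≠ 0 → IsMaxLik M.carrier x q →
        lo x ≤ klDivergence q (M.prob θ₀) ∧ klDivergence q (M.prob θ₀) ≤ hi x) ∧
      HasExpansion (fun n => expect (M.prob θ₀) n lo) (s / 2) (A / 24) ∧
      HasExpansion (fun n => expect (M.prob θ₀) n hi) (s / 2) (A / 24) := by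
  obtain ⟨g, G, hg0, hg, hG, hGs, hest⟩ := exists_smooth_estimate h
  obtain ⟨T, C, hTO, hT⟩ := exists_polynomial_approx h hg0 hg hest
  have hKL := klDivergence_estimate_sub_isLittleO h hg0 hG
  have htrace := sum_sq_fisher_projection h hGs
  set p := M.prob θ₀ with hpdef
  have hp := M.prob_pos θ₀ h
  have hp0 : ∀ a, 0 ≤ p a := fun a => (hp a).le
  have hp1 := M.prob_sum θ₀ h
  set P : (Fin J → ℝ) → ℝ := fun v => ∑ k ∈ Finset.range 4, T k fun _ => v with hP
  set S : (Fin J → ℝ) → ℝ := fun v => ∑ a, |v a| ^ 5 with hS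
  set Q : (Fin J → ℝ) → ℝ := fun v => ∑ a, (2 * p a)⁻¹ * M.cellDeriv a θ₀ (G v) ^ 2 with hQ
  have hSexp : HasExpansion (fun n => expect p n fun x => |C| * S (deviation p x)) 0 0 := by
    have h1 := (HasExpansion.sum (s := univ) fun a _ =>
      hasExpansion_abs_deviation_pow_five hp0 hp1 a).const_mul |C|
    simp only [Finset.sum_const_zero, mul_zero] at h1
    refine h1.congr (Eventually.of_forall fun n => ?_)
    simp only [hS, expect_const_mul, expect_sum]
  obtain ⟨a, b, hab⟩ : ∃ a b, HasExpansion (fun n => expect p n fun x => P (deviation p x)) a b := by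
    choose! a b hab using fun (k : ℕ) (hk : k ∈ Finset.range 4) =>
      exists_hasExpansion_multilinear hp1 (Finset.mem_range.1 hk) (T k).toMultilinearMap
    refine ⟨_, _, (HasExpansion.sum hab).congr (Eventually.of_forall fun n => ?_)⟩
    simp only [hP, expect_sum]
    rfl
  have hPc : Continuous P := continuous_finsetSum _ fun k _ =>
    (T k).cont.comp (continuous_pi fun _ => continuous_id)
  have hSc : Continuous S := continuous_finsetSum _ fun k _ => by fun_prop
  have hQc : Continuous Q := continuous_finsetSum _ fun k _ => by fun_prop
  have hbdd : ∀ F : (Fin J → ℝ) → ℝ, Continuous F → ∃ B, ∀ v, ‖v‖ ≤ 1 → |F v| ≤ B := by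
    intro F hF
    obtain ⟨B, hB⟩ := (isCompact_closedBall (0 : Fin J → ℝ) 1).exists_bound_of_continuousOn
      hF.continuousOn
    exact ⟨B, fun v hv => hB v (by simpa using hv)⟩
  have hdev := norm_deviation_le_one hp0 hp1
  -- The Taylor polynomial P and the quadratic form Q both approximate the loss to o(‖v‖²), so n
  -- E[P] and n E[Q] have the same limit, and the latter is s/2 by the trace identity.
  have ha : a = s / 2 := by
    have hPQ : (fun v => P v - Q v) =o[𝓝 0] fun v => ‖v‖ ^ 2 := by
      have h5 : (fun v : Fin J → ℝ => ‖v‖ ^ 5) =o[𝓝 0] fun v => ‖v‖ ^ 2 := by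
        have h3 : (fun v : Fin J → ℝ => ‖v‖ ^ 3) =o[𝓝 0] fun _ => (1 : ℝ) := by
          rw [isLittleO_one_iff]
          have : Continuous fun v : Fin J → ℝ => ‖v‖ ^ 3 := by fun_prop
          simpa using this.tendsto 0
        have := (isBigO_refl (fun v : Fin J → ℝ => ‖v‖ ^ 2) (𝓝 0)).mul_isLittleO h3
        exact (this.congr_left fun v => by ring).congr_right fun v => by ring
      exact (hKL.sub (hTO.trans_isLittleO h5)).congr_left fun v => by simp only [hP, hQ]; ring
    obtain ⟨B, hB⟩ := hbdd _ (hPc.sub hQc)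
    have hlim := tendsto_mul_expect_of_abs_le hp0 hp1
      (f := fun x => P (deviation p x) - Q (deviation p x)) fun ε hε => by
        obtain ⟨C', hC'⟩ := exists_bound_of_isLittleO_sq hPQ hB hε
        exact ⟨C', fun x _ => hC' _ (hdev x)⟩
    have hQe : ∀ n : ℕ, n ≠ 0 → n * expect p n (fun x => Q (deviation p x)) = s / 2 := by
      intro n hn
      have hn' : (n : ℝ) ≠ 0 := by exact_mod_cast hn
      have e : ∀ a, expect p n (fun x => M.cellDeriv a θ₀ (G (deviation p x)) ^ 2) =
          (∑ b, p b * M.cellDeriv a θ₀ (G (Pi.single b 1 - p)) ^ 2) / n := fun a =>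
        expect_map_deviation_sq hp1
          ((M.cellDeriv a θ₀ ∘L G : (Fin J → ℝ) →L[ℝ] ℝ) : (Fin J → ℝ) →ₗ[ℝ] ℝ) hn
      simp only [hQ, expect_sum, expect_const_mul, e]
      rw [← htrace, Finset.mul_sum, Finset.sum_div]
      refine Finset.sum_congr rfl fun a _ => ?_
      have := (hp a).ne'
      field_simp
    have h1 := hlim.add_const ((s : ℝ) / 2)
    rw [zero_add] at h1
    refine tendsto_nhds_unique hab.tendsto_mul (h1.congr' ?_)
    filter_upwards [eventually_ne_atTop 0] with n hn
    rw [expect_sub, mul_sub, hQe n hn, sub_add_cancel]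
  subst ha
  obtain ⟨B, hB⟩ := hbdd _ hPc
  obtain ⟨B', hB'⟩ := hbdd _ (hSc.const_mul |C|)
  -- The envelope is the polynomial plus or minus the fifth-order error. Neither function mentions
  -- an estimator, so b does not depend on one.
  refine ⟨24 * b, B + B', fun x => P (deviation p x) - |C| * S (deviation p x),
    fun x => P (deviation p x) + |C| * S (deviation p x), fun x => ?_, fun x => ?_,
    fun x q hx hq => ?_, ?_, ?_⟩
  · exact (abs_sub _ _).trans (add_le_add (hB _ (hdev x)) (hB' _ (hdev x)))
  · exact (abs_add_le _ _).trans (add_le_add (hB _ (hdev x)) (hB' _ (hdev x)))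
  · have h1 := hT x q hx hq
    have h2 : C * ‖deviation p x‖ ^ 5 ≤ |C| * S (deviation p x) :=
      mul_le_mul (le_abs_self C) (norm_pow_le_sum_abs_pow _ (by norm_num)) (by positivity)
        (abs_nonneg _)
    have h3 := abs_le.1 (h1.trans h2)
    constructor <;> simp only [hP] <;> linarith [h3.1, h3.2]
  · have := hab.sub hSexp
    simp only [sub_zero, ← expect_sub] at this
    rwa [mul_div_cancel_left₀ _ (by norm_num : (24 : ℝ) ≠ 0)]
  · have := hab.add hSexp
    simp only [add_zero, ← expect_add] at this
    rwa [mul_div_cancel_left₀ _ (by norm_num : (24 : ℝ) ≠ 0)]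

end ParametricModel

/-! ### From a fixed to a binomial sample size -/

section Binomial

/-- `E[g(N)]` for `N` binomial with `n` trials and success probability `c`. -/
def binomialExpect (c : ℝ) (n : ℕ) (g : ℕ → ℝ) : ℝ :=
  expect (fun b : Bool => if b then c else 1 - c) n fun x => g (x true)

variable {c : ℝ} {n : ℕ}

theorem binomialExpect_zero (g : ℕ → ℝ) : binomialExpect c 0 g = g 0 := by
  simp [binomialExpect, expect_zero_size]

theorem binomialExpect_succ (g : ℕ → ℝ) : binomialExpect c (n + 1) g =
    c * binomialExpect c n (fun k => g (k + 1)) + (1 - c) * binomialExpect c n g := by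
  simp [binomialExpect, expect_succ]

theorem binomialExpect_add (f g : ℕ → ℝ) : binomialExpect c n (fun k => f k + g k) =
    binomialExpect c n f + binomialExpect c n g := expect_add _ _

theorem binomialExpect_const_mul (r : ℝ) (g : ℕ → ℝ) :
    binomialExpect c n (fun k => r * g k) = r * binomialExpect c n g := expect_const_mul _ _

theorem binomialExpect_sum {ι : Type*} (s : Finset ι) (f : ι → ℕ → ℝ) :
    binomialExpect c n (fun k => ∑ i ∈ s, f i k) = ∑ i ∈ s, binomialExpect c n (f i) :=
  expect_sum s _

theorem binomialExpect_const (r : ℝ) : binomialExpect c n (fun _ => r) = r :=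
  expect_const (by simp) r

theorem binomialExpect_mono (hc : 0 ≤ c) (hc1 : c ≤ 1) {f g : ℕ → ℝ} (h : ∀ k, f k ≤ g k) :
    binomialExpect c n f ≤ binomialExpect c n g :=
  expect_mono (by intro b; cases b <;> simp <;> linarith) fun x _ => h _

/-- The size-biasing identity of the binomial distribution. -/
theorem binomialExpect_size_bias (f : ℕ → ℝ) :
    binomialExpect c (n + 1) (fun k => k * f k) =
      (n + 1) * c * binomialExpect c n fun k => f (k + 1) := by
  induction n generalizing f with
  | zero => rw [binomialExpect_succ]; simp [binomialExpect_zero]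
  | succ n ih =>
    rw [binomialExpect_succ, ih f]
    have e : (fun k : ℕ => ((k + 1 : ℕ) : ℝ) * f (k + 1)) = fun k : ℕ =>
        k * (fun k => f (k + 1)) k + f (k + 1) := by
      ext k; push_cast; ring
    rw [e, binomialExpect_add, ih (fun k => f (k + 1)), binomialExpect_succ (n := n)]
    push_cast
    ring

theorem binomialExpect_indicator_zero :
    binomialExpect c n (fun k => if k = 0 then 1 else 0) = (1 - c) ^ n := by
  induction n with
  | zero => simp [binomialExpect_zero]
  | succ n ih =>
    rw [binomialExpect_succ, ih]
    simp only [Nat.add_eq_zero_iff, one_ne_zero, and_false, if_false, binomialExpect_const]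
    ring

/-- Size biasing lowers reciprocals of rising products one factor at a time. This is why expansions
are tested against 1/(k+1) and 1/((k+1)(k+2)), which are also finite at k = 0, and not against
powers of 1/k. -/
theorem binomialExpect_inv_succ (hc : 0 < c) :
    binomialExpect c n (fun k => ((k : ℝ) + 1)⁻¹) = (1 - (1 - c) ^ (n + 1)) / ((n + 1) * c) := by
  have h := binomialExpect_size_bias (c := c) (n := n) fun k => (k : ℝ)⁻¹
  -- With 0⁻¹ = 0 the product is 0 at k = 0, which is the source of the term (1-c)^(n+1).
  have e : (fun k : ℕ => (k : ℝ) * (k : ℝ)⁻¹) =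
      fun k : ℕ => 1 + -1 * (if k = 0 then 1 else 0) := by
    ext k
    rcases eq_or_ne k 0 with rfl | hk
    · simp
    · have : (k : ℝ) ≠ 0 := by exact_mod_cast hk
      simp [hk]
  rw [e, binomialExpect_add, binomialExpect_const, binomialExpect_const_mul,
    binomialExpect_indicator_zero] at h
  push_cast at h
  rw [eq_div_iff (by positivity), mul_comm, ← h]
  ring

theorem binomialExpect_inv_mul_succ (hc : 0 < c) :
    binomialExpect c n (fun k => (((k : ℝ) + 1) * (k + 2))⁻¹) =
      (binomialExpect c (n + 1) (fun k => ((k : ℝ) + 1)⁻¹) - (1 - c) ^ (n + 1)) / ((n + 1) * c) := by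
  have h := binomialExpect_size_bias (c := c) (n := n) fun k => ((k : ℝ) * (k + 1))⁻¹
  have e : (fun k : ℕ => (k : ℝ) * ((k : ℝ) * (k + 1))⁻¹) =
      fun k : ℕ => ((k : ℝ) + 1)⁻¹ + -1 * (if k = 0 then 1 else 0) := by
    ext k
    rcases eq_or_ne k 0 with rfl | hk
    · simp
    · have : (k : ℝ) ≠ 0 := by exact_mod_cast hk
      simp [hk]
      field_simp
  have e' : (fun k : ℕ => (((k : ℝ) + 1) * (k + 2))⁻¹) =
      fun k : ℕ => (((k + 1 : ℕ) : ℝ) * (((k + 1 : ℕ) : ℝ) + 1))⁻¹ := by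
    ext k; push_cast; ring
  rw [e, binomialExpect_add, binomialExpect_const_mul, binomialExpect_indicator_zero, ← e'] at h
  rw [eq_div_iff (by positivity), mul_comm, ← h]
  ring

/-- The third reciprocal only enters an error term, so the correction at k = 0 is dropped and an
inequality suffices. -/
theorem binomialExpect_inv_mul₃_le (hc : 0 < c) (hc1 : c ≤ 1) :
    binomialExpect c n (fun k => (((k : ℝ) + 1) * (k + 2) * (k + 3))⁻¹) ≤
      binomialExpect c (n + 1) (fun k => (((k : ℝ) + 1) * (k + 2))⁻¹) / ((n + 1) * c) := by
  have h := binomialExpect_size_bias (c := c) (n := n) fun k => ((k : ℝ) * (k + 1) * (k + 2))⁻¹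
  have e' : (fun k : ℕ => (((k : ℝ) + 1) * (k + 2) * (k + 3))⁻¹) =
      fun k : ℕ => (((k + 1 : ℕ) : ℝ) * (((k + 1 : ℕ) : ℝ) + 1) * (((k + 1 : ℕ) : ℝ) + 2))⁻¹ := by
    ext k; push_cast; ring
  rw [← e'] at h
  rw [le_div_iff₀ (by positivity), mul_comm, ← h]
  refine binomialExpect_mono hc.le hc1 fun k => ?_
  rcases eq_or_ne k 0 with rfl | hk
  · simp
  · have : (k : ℝ) ≠ 0 := by exact_mod_cast hk
    refine le_of_eq ?_
    field_simp

theorem sq_mul_binomialExpect_inv_mul_le (hc : 0 < c) (hc1 : c ≤ 1) :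
    (n : ℝ) ^ 2 * binomialExpect c n (fun k => (((k : ℝ) + 1) * (k + 2))⁻¹) ≤ (c ^ 2)⁻¹ := by
  rw [binomialExpect_inv_mul_succ hc, binomialExpect_inv_succ hc]
  have h1 : 0 ≤ (1 - c) ^ (n + 1) := pow_nonneg (by linarith) _
  have h2 : 0 ≤ (1 - c) ^ (n + 1 + 1) := pow_nonneg (by linarith) _
  calc _ ≤ (n : ℝ) ^ 2 * ((1 / (((n + 1 : ℕ) + 1 : ℝ) * c)) / ((n + 1) * c)) := by
        gcongr
        have : (1 - (1 - c) ^ (n + 1 + 1)) / (((n + 1 : ℕ) + 1 : ℝ) * c) ≤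
            1 / (((n + 1 : ℕ) + 1 : ℝ) * c) := by gcongr; linarith
        linarith
    _ ≤ _ := by
        push_cast
        rw [div_div, mul_one_div, div_le_iff₀ (by positivity)]
        have : (c ^ 2)⁻¹ * (((n : ℝ) + 1 + 1) * c * ((n + 1) * c)) = (n + 1 + 1) * (n + 1) := by
          field_simp
        rw [this]
        nlinarith [(Nat.cast_nonneg n : (0 : ℝ) ≤ n)]

theorem cube_mul_binomialExpect_inv_mul₃_le (hc : 0 < c) (hc1 : c ≤ 1) :
    (n : ℝ) ^ 3 * binomialExpect c n (fun k => (((k : ℝ) + 1) * (k + 2) * (k + 3))⁻¹) ≤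
      (c ^ 3)⁻¹ := by
  have h1 := binomialExpect_inv_mul₃_le (n := n) hc hc1
  have h2 := sq_mul_binomialExpect_inv_mul_le (n := n + 1) hc hc1
  push_cast at h2
  have h0 : 0 ≤ binomialExpect c (n + 1) (fun k => (((k : ℝ) + 1) * (k + 2))⁻¹) := by
    rw [← binomialExpect_const (c := c) (n := n + 1) 0]
    exact binomialExpect_mono hc.le hc1 fun k => by positivity
  calc _ ≤ ((n : ℝ) + 1) ^ 3 * (binomialExpect c (n + 1) (fun k => (((k : ℝ) + 1) * (k + 2))⁻¹) /
        ((n + 1) * c)) := by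
        refine mul_le_mul (by gcongr; linarith) h1 ?_ (by positivity)
        rw [← binomialExpect_const (c := c) (n := n) 0]
        exact binomialExpect_mono hc.le hc1 fun k => by positivity
    _ = (((n : ℝ) + 1) ^ 2 * binomialExpect c (n + 1) (fun k => (((k : ℝ) + 1) * (k + 2))⁻¹)) / c := by
        field_simp
    _ ≤ (c ^ 2)⁻¹ / c := by gcongr
    _ = _ := by field_simp

theorem hasExpansion_mul_pow (hc : 0 < c) (hc1 : c ≤ 1) {f : ℕ → ℝ} {K : ℝ}
    (hf : ∀ n, |f n| ≤ K) : HasExpansion (fun n => f n * (1 - c) ^ n) 0 0 := by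
  refine hasExpansion_of_tendsto ?_
  have h := (tendsto_pow_const_mul_const_pow_of_abs_lt_one 2
    (show |1 - c| < 1 by rw [abs_lt]; constructor <;> linarith)).const_mul K
  rw [mul_zero] at h
  refine squeeze_zero_norm (fun n => ?_) h
  have h0 : 0 ≤ (1 - c) ^ n := pow_nonneg (by linarith) _
  rw [Real.norm_eq_abs, abs_mul, abs_mul, abs_of_nonneg h0, abs_of_nonneg (by positivity)]
  calc (n : ℝ) ^ 2 * (|f n| * (1 - c) ^ n) ≤ (n : ℝ) ^ 2 * (K * (1 - c) ^ n) := by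
        gcongr; exact hf n
    _ = _ := by ring

theorem hasExpansion_inv_succ : HasExpansion (fun n : ℕ => ((n : ℝ) + 1)⁻¹) 1 (-1) := by
  rw [hasExpansion_iff_tendsto]
  have := tendsto_one_div_add_atTop_nhds_zero_nat (𝕜 := ℝ)
  refine this.congr fun n => ?_
  have : (n : ℝ) + 1 ≠ 0 := by positivity
  field_simp
  ring

theorem hasExpansion_inv_mul_succ :
    HasExpansion (fun n : ℕ => (((n : ℝ) + 1) * (n + 2))⁻¹) 0 1 := by
  refine hasExpansion_of_tendsto ?_
  have h1 := tendsto_one_div_add_atTop_nhds_zero_nat (𝕜 := ℝ)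
  have h2 := (tendsto_natCast_div_add_atTop (1 : ℝ)).mul (tendsto_natCast_div_add_atTop (2 : ℝ))
  rw [mul_one] at h2
  refine h2.congr fun n => ?_
  rw [div_mul_div_comm, div_eq_mul_inv]
  ring

theorem hasExpansion_binomialExpect_inv_succ (hc : 0 < c) (hc1 : c ≤ 1) :
    HasExpansion (fun n => binomialExpect c n fun k => ((k : ℝ) + 1)⁻¹) c⁻¹ (-c⁻¹) := by
  have h := (hasExpansion_inv_succ.const_mul c⁻¹).sub
    (hasExpansion_mul_pow hc hc1 (f := fun n => c⁻¹ * (1 - c) * ((n : ℝ) + 1)⁻¹)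
      (K := c⁻¹ * 1 * 1) fun n => ?_)
  · simp only [mul_one, sub_zero, mul_neg] at h
    refine h.congr (Eventually.of_forall fun n => ?_)
    rw [binomialExpect_inv_succ hc]
    have : (n : ℝ) + 1 ≠ 0 := by positivity
    field_simp
    ring
  · have h1 : 0 ≤ 1 - c := by linarith
    rw [abs_of_nonneg (by positivity)]
    gcongr
    · linarith
    · exact inv_le_one_of_one_le₀ (by linarith [(Nat.cast_nonneg n : (0 : ℝ) ≤ n)])

theorem hasExpansion_binomialExpect_inv_mul_succ (hc : 0 < c) (hc1 : c ≤ 1) :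
    HasExpansion (fun n => binomialExpect c n fun k => (((k : ℝ) + 1) * (k + 2))⁻¹) 0
      (c ^ 2)⁻¹ := by
  have h1 : 0 ≤ 1 - c := by linarith
  have h := (hasExpansion_inv_mul_succ.const_mul (c ^ 2)⁻¹).sub
    (hasExpansion_mul_pow hc hc1
      (f := fun n => (c ^ 2)⁻¹ * (1 - c) * (1 - c) * ((n : ℝ) + 1)⁻¹ * ((n : ℝ) + 2)⁻¹ +
        c⁻¹ * (1 - c) * ((n : ℝ) + 1)⁻¹)
      (K := (c ^ 2)⁻¹ * 1 * 1 * 1 * 1 + c⁻¹ * 1 * 1) fun n => ?_)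
  · simp only [mul_one, sub_zero, mul_zero] at h
    refine h.congr (Eventually.of_forall fun n => ?_)
    rw [binomialExpect_inv_mul_succ hc, binomialExpect_inv_succ hc]
    have h1 : (n : ℝ) + 1 ≠ 0 := by positivity
    have h2 : (n : ℝ) + 2 ≠ 0 := by positivity
    have h3 : (n : ℝ) + 1 + 1 ≠ 0 := by positivity
    push_cast
    rw [show (n : ℝ) + 2 = n + 1 + 1 by ring]
    field_simp
    ring
  · have hn : (0 : ℝ) ≤ n := Nat.cast_nonneg n
    rw [abs_of_nonneg (by positivity)]
    have e1 : ((n : ℝ) + 1)⁻¹ ≤ 1 := inv_le_one_of_one_le₀ (by linarith)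
    have e2 : ((n : ℝ) + 2)⁻¹ ≤ 1 := inv_le_one_of_one_le₀ (by linarith)
    have e3 : 1 - c ≤ 1 := by linarith
    gcongr

/-- Expansions are transferred from a fixed sample size to a binomial sample size. -/
theorem HasExpansion.binomialExpect (hc : 0 < c) (hc1 : c ≤ 1) {g : ℕ → ℝ} {a b : ℝ}
    (hg : HasExpansion g a b) :
    HasExpansion (fun n => binomialExpect c n g) (a / c) ((a * (1 - c) + b) / c ^ 2) := by
  set u₁ : ℕ → ℝ := fun k => ((k : ℝ) + 1)⁻¹ with hu₁
  set u₂ : ℕ → ℝ := fun k => (((k : ℝ) + 1) * (k + 2))⁻¹ with hu₂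
  set u₃ : ℕ → ℝ := fun k => (((k : ℝ) + 1) * (k + 2) * (k + 3))⁻¹ with hu₃
  -- Since 1/(k+1) = 1/k - 1/k² + o(k⁻²), removing `a * u₁` raises the second coefficient from b to
  -- a + b.
  set ρ : ℕ → ℝ := fun k => g k - a * u₁ k - (a + b) * u₂ k with hρ
  have hρexp : HasExpansion ρ 0 0 := by
    have := (hg.sub (hasExpansion_inv_succ.const_mul a)).sub
      (hasExpansion_inv_mul_succ.const_mul (a + b))
    have e1 : a - a * 1 - (a + b) * 0 = 0 := by ring
    have e2 : b - a * -1 - (a + b) * 1 = 0 := by ring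
    rwa [e1, e2] at this
  have hbound : ∀ ε > 0, ∃ C ≥ 0, ∀ k, |ρ k| ≤ ε * u₂ k + C * u₃ k := by
    intro ε hε
    have h1 := hρexp.tendsto_sq_mul.abs
    rw [abs_zero] at h1
    -- The 6 pays for (k+1)(k+2) ≤ 6k² when k ≥ 1. The finitely many small k, on which nothing is
    -- assumed, are absorbed by a multiple of `u₃`, whose binomial expectation is O(n⁻³).
    obtain ⟨N, hN⟩ := (h1.eventually_lt_const (show 0 < ε / 6 by positivity)).exists_forall_of_atTop
    refine ⟨∑ k ∈ Finset.range (N + 1), |ρ k| / u₃ k,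
      Finset.sum_nonneg fun k _ => by positivity, fun k => ?_⟩
    have hu2 : 0 < u₂ k := by positivity
    have hu3 : 0 < u₃ k := by positivity
    have hS : 0 ≤ ∑ k ∈ Finset.range (N + 1), |ρ k| / u₃ k :=
      Finset.sum_nonneg fun k _ => by positivity
    rcases lt_or_ge k (N + 1) with hk | hk
    · have h2 : |ρ k| / u₃ k ≤ ∑ k ∈ Finset.range (N + 1), |ρ k| / u₃ k :=
        Finset.single_le_sum (f := fun k => |ρ k| / u₃ k) (fun k _ => by positivity)
          (Finset.mem_range.2 hk)
      calc |ρ k| = |ρ k| / u₃ k * u₃ k := by field_simp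
        _ ≤ (∑ k ∈ Finset.range (N + 1), |ρ k| / u₃ k) * u₃ k := by gcongr
        _ ≤ _ := le_add_of_nonneg_left (by positivity)
    · have h2 := hN k (by omega)
      have hk1 : (1 : ℝ) ≤ k := by exact_mod_cast (by omega : 1 ≤ k)
      rw [abs_mul, abs_of_nonneg (by positivity)] at h2
      have h3 : |ρ k| ≤ ε * u₂ k := by
        simp only [hu₂]
        rw [← div_eq_mul_inv, le_div_iff₀ (by positivity)]
        have h4 : ((k : ℝ) + 1) * (k + 2) ≤ 6 * k ^ 2 := by nlinarith
        calc |ρ k| * (((k : ℝ) + 1) * (k + 2)) ≤ |ρ k| * (6 * k ^ 2) := by gcongr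
          _ = 6 * (k ^ 2 * |ρ k|) := by ring
          _ ≤ ε := by linarith
      exact h3.trans (le_add_of_nonneg_right (by positivity))
  have hρ0 : HasExpansion (fun n => TwoStage.binomialExpect c n ρ) 0 0 := by
    refine hasExpansion_of_tendsto ?_
    rw [Metric.tendsto_atTop]
    intro ε hε
    obtain ⟨C, hC0, hC⟩ := hbound (ε / 2 * c ^ 2) (by positivity)
    have hlim : Tendsto (fun n : ℕ => (n : ℝ)⁻¹ * (C * (c ^ 3)⁻¹)) atTop (𝓝 0) := by
      simpa using (tendsto_inv_atTop_nhds_zero_nat (𝕜 := ℝ)).mul_const (C * (c ^ 3)⁻¹)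
    obtain ⟨N, hN⟩ := (hlim.eventually_lt_const (half_pos hε)).exists_forall_of_atTop
    refine ⟨N + 1, fun n hn => ?_⟩
    have hn' : (0 : ℝ) < n := by exact_mod_cast (by omega : 0 < n)
    have hle : ∀ f : ℕ → ℝ, (∀ k, f k ≤ |ρ k|) →
        (n : ℝ) ^ 2 * TwoStage.binomialExpect c n f < ε := by
      intro f hf
      have h1 : TwoStage.binomialExpect c n f ≤
          ε / 2 * c ^ 2 * TwoStage.binomialExpect c n u₂ + C * TwoStage.binomialExpect c n u₃ := by
        rw [← binomialExpect_const_mul, ← binomialExpect_const_mul, ← binomialExpect_add]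
        exact binomialExpect_mono hc.le hc1 fun k => (hf k).trans (hC k)
      have h2 := sq_mul_binomialExpect_inv_mul_le (n := n) hc hc1
      have h3 := cube_mul_binomialExpect_inv_mul₃_le (n := n) hc hc1
      have h4 := hN n (by omega)
      calc (n : ℝ) ^ 2 * TwoStage.binomialExpect c n f ≤ (n : ℝ) ^ 2 *
            (ε / 2 * c ^ 2 * TwoStage.binomialExpect c n u₂ +
              C * TwoStage.binomialExpect c n u₃) := by gcongr
        _ = ε / 2 * c ^ 2 * ((n : ℝ) ^ 2 * TwoStage.binomialExpect c n u₂) +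
            (n : ℝ)⁻¹ * (C * ((n : ℝ) ^ 3 * TwoStage.binomialExpect c n u₃)) := by
          field_simp
        _ ≤ ε / 2 * c ^ 2 * (c ^ 2)⁻¹ + (n : ℝ)⁻¹ * (C * (c ^ 3)⁻¹) := by gcongr
        _ < ε := by
          rw [mul_assoc, mul_inv_cancel₀ (by positivity)]
          linarith
    have h1 := hle ρ fun k => le_abs_self _
    have h2 := hle (fun k => -1 * ρ k) fun k => by rw [neg_one_mul]; exact neg_le_abs _
    rw [binomialExpect_const_mul] at h2
    rw [Real.dist_eq, sub_zero, abs_lt]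
    constructor <;> linarith
  have h := (((hasExpansion_binomialExpect_inv_succ hc hc1).const_mul a).add
    ((hasExpansion_binomialExpect_inv_mul_succ hc hc1).const_mul (a + b))).add hρ0
  have e1 : a * c⁻¹ + (a + b) * 0 + 0 = a / c := by ring
  have e2 : a * -c⁻¹ + (a + b) * (c ^ 2)⁻¹ + 0 = (a * (1 - c) + b) / c ^ 2 := by
    field_simp; ring
  rw [e1, e2] at h
  refine h.congr (Eventually.of_forall fun n => ?_)
  rw [← binomialExpect_const_mul, ← binomialExpect_const_mul, ← binomialExpect_add,
    ← binomialExpect_add]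
  congr 1
  ext k
  simp only [hρ]
  ring

end Binomial

/-! ### The law of the counts of one group -/

section Marginal

variable {I : ℕ} {J : Fin I → ℕ} {c : Fin I → ℝ} {p : (i : Fin I) → Fin (J i) → ℝ}

/-- The counts of the `i`-th group. -/
def groupCounts (i : Fin I) (x : Cell J → ℕ) : Fin (J i) → ℕ := fun j => x ⟨i, j⟩

theorem groupCounts_add_single_self (i : Fin I) (j : Fin (J i)) (x : Cell J → ℕ) :
    groupCounts i (x + Pi.single ⟨i, j⟩ 1) = groupCounts i x + Pi.single j 1 := by
  ext k
  by_cases h : k = j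
  · subst h; simp [groupCounts]
  · have : (⟨i, k⟩ : Cell J) ≠ ⟨i, j⟩ := fun e => h (by simpa using e)
    simp [groupCounts, h, this]

theorem groupCounts_add_single_of_ne {i i' : Fin I} (h : i' ≠ i) (j : Fin (J i'))
    (x : Cell J → ℕ) : groupCounts i (x + Pi.single ⟨i', j⟩ 1) = groupCounts i x := by
  ext k
  have : (⟨i, k⟩ : Cell J) ≠ ⟨i', j⟩ := fun e => h (congrArg Sigma.fst e).symm
  simp [groupCounts, this]

/-- Given the size of a group, its counts are multinomial with the second-stage probabilities. -/
theorem expect_groupCounts (hc1 : ∑ i, c i = 1) (hp1 : ∀ i, ∑ j, p i j = 1) (i : Fin I) (n : ℕ)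
    (F : (Fin (J i) → ℕ) → ℝ) :
    expect (cellProb c p) n (fun x => F (groupCounts i x)) =
      binomialExpect (c i) n fun k => expect (p i) k F := by
  induction n generalizing F with
  | zero => rw [expect_zero_size, binomialExpect_zero, expect_zero_size]; rfl
  | succ n ih =>
    -- The separated trial either falls into group i, adding to its counts, or elsewhere with total
    -- probability 1 - c i, leaving them unchanged.
    rw [expect_succ, binomialExpect_succ, Fintype.sum_sigma, ← Finset.add_sum_erase _ _ (mem_univ i)]
    congr 1
    · simp only [groupCounts_add_single_self, expect_succ, binomialExpect_sum,
        binomialExpect_const_mul, Finset.mul_sum]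
      refine Finset.sum_congr rfl fun j _ => ?_
      have h := ih fun y => F (y + Pi.single j 1)
      exact (congrArg (cellProb c p ⟨i, j⟩ * ·) h).trans (mul_assoc _ _ _)
    · have : ∀ i' ∈ univ.erase i, ∑ j, cellProb c p ⟨i', j⟩ *
          expect (cellProb c p) n (fun x => F (groupCounts i (x + Pi.single ⟨i', j⟩ 1))) =
          c i' * binomialExpect (c i) n fun k => expect (p i) k F := by
        intro i' hi'
        simp only [groupCounts_add_single_of_ne (Finset.ne_of_mem_erase hi'), ih, cellProb,
          ← Finset.sum_mul, ← Finset.mul_sum, hp1, mul_one]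
      rw [Finset.sum_congr rfl this, ← Finset.sum_mul]
      congr 1
      rw [← hc1, ← Finset.add_sum_erase _ _ (mem_univ i), add_sub_cancel_left]

end Marginal

/-! ### The risk of relative frequencies, computed explicitly -/

section FullModel

theorem abs_log_one_add_sub_le_four {t : ℝ} (ht : |t| ≤ 1 / 2) :
    |Real.log (1 + t) - (t - t ^ 2 / 2 + t ^ 3 / 3 - t ^ 4 / 4)| ≤ 2 * |t| ^ 5 := by
  have h := Real.abs_log_sub_add_sum_range_le (x := -t) (by rw [abs_neg]; linarith) 4
  simp only [Finset.sum_range_succ, Finset.sum_range_zero, abs_neg, sub_neg_eq_add] at h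
  push_cast at h
  have e : |Real.log (1 + t) - (t - t ^ 2 / 2 + t ^ 3 / 3 - t ^ 4 / 4)| =
      |0 + (-t) ^ (0 + 1) / (0 + 1) + (-t) ^ (1 + 1) / (1 + 1) + (-t) ^ (2 + 1) / (2 + 1) +
        (-t) ^ (3 + 1) / (3 + 1) + Real.log (1 + t)| := by
    congr 1; ring
  rw [e]
  refine h.trans ?_
  rw [div_le_iff₀ (by linarith)]
  have : 0 ≤ |t| ^ 5 := by positivity
  nlinarith

/-- The Taylor polynomial of degree four of `(r + v) log ((r + v) / r)` at `v = 0`. -/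
def entropyPoly (r v : ℝ) : ℝ := v + (2 * r)⁻¹ * v ^ 2 - (6 * r ^ 2)⁻¹ * v ^ 3 +
  (12 * r ^ 3)⁻¹ * v ^ 4

/-- Near 0 this is the logarithmic series; for r/2 < |v| ≤ 1 the difference is bounded by continuity
and |v|⁵ is bounded below. -/
theorem exists_abs_sub_entropyPoly_le {r : ℝ} (hr : 0 < r) :
    ∃ C, ∀ v, |v| ≤ 1 → |(r + v) * Real.log ((r + v) / r) - entropyPoly r v| ≤ C * |v| ^ 5 := by
  have hc : Continuous fun v => (r + v) * Real.log ((r + v) / r) - entropyPoly r v := by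
    have e : (fun v => (r + v) * Real.log ((r + v) / r) - entropyPoly r v) =
        fun v => r * ((r + v) / r * Real.log ((r + v) / r)) - entropyPoly r v := by
      ext v; field_simp
    rw [e]
    have h1 : Continuous fun v => (r + v) / r * Real.log ((r + v) / r) :=
      Real.continuous_mul_log.comp (f := fun v => (r + v) / r) (by fun_prop)
    unfold entropyPoly
    fun_prop
  obtain ⟨B, hB⟩ := (isCompact_Icc (a := (-1 : ℝ)) (b := 1)).exists_bound_of_continuousOn
    hc.continuousOn
  have hB0 : 0 ≤ B := (norm_nonneg _).trans (hB 0 (by simp))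
  refine ⟨max (4 * r * (r ^ 5)⁻¹) (B * ((r / 2) ^ 5)⁻¹), fun v hv => ?_⟩
  rcases le_or_gt |v| (r / 2) with h | h
  · set t := v / r with ht
    have hvt : v = r * t := by rw [ht]; field_simp
    have htb : |t| ≤ 1 / 2 := by
      rw [ht, abs_div, abs_of_pos hr, div_le_iff₀ hr]; linarith
    have hlog := abs_log_one_add_sub_le_four htb
    have e : (r + v) * Real.log ((r + v) / r) - entropyPoly r v =
        r * ((1 + t) * (Real.log (1 + t) - (t - t ^ 2 / 2 + t ^ 3 / 3 - t ^ 4 / 4)) -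
          t ^ 5 / 4) := by
      rw [hvt, show (r + r * t) / r = 1 + t by field_simp, entropyPoly]
      field_simp
      ring
    have h1 : |1 + t| ≤ 3 / 2 := (abs_add_le _ _).trans (by rw [abs_one]; linarith)
    have h2 : |(1 + t) * (Real.log (1 + t) - (t - t ^ 2 / 2 + t ^ 3 / 3 - t ^ 4 / 4)) -
        t ^ 5 / 4| ≤ 4 * |t| ^ 5 := by
      refine (abs_sub _ _).trans ?_
      rw [abs_mul, abs_div, abs_pow, abs_of_pos (by norm_num : (0 : ℝ) < 4)]
      have : |1 + t| * |Real.log (1 + t) - (t - t ^ 2 / 2 + t ^ 3 / 3 - t ^ 4 / 4)| ≤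
        3 / 2 * (2 * |t| ^ 5) := by gcongr
      have : 0 ≤ |t| ^ 5 := by positivity
      linarith
    rw [e, abs_mul, abs_of_pos hr]
    calc r * _ ≤ r * (4 * |t| ^ 5) := by gcongr
      _ = 4 * r * (r ^ 5)⁻¹ * |v| ^ 5 := by
        rw [hvt, abs_mul, abs_of_pos hr, mul_pow]; field_simp
      _ ≤ _ := by gcongr; exact le_max_left _ _
  · calc _ ≤ B := hB v (abs_le.1 hv)
      _ = B * ((r / 2) ^ 5)⁻¹ * (r / 2) ^ 5 := by field_simp
      _ ≤ B * ((r / 2) ^ 5)⁻¹ * |v| ^ 5 := by gcongr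
      _ ≤ _ := by gcongr; exact le_max_right _ _

variable {α : Type*} [Fintype α] {p : α → ℝ}

/-- Use t ≤ exp(t - 1) at t = r/f in each occupied cell: the exponents sum to at most 0. Working
with exponentials avoids logarithms of empty cells, which contribute the factor exp(N r) ≥ 1. -/
theorem multinomialProb_le_relFreq {r : α → ℝ} (hr : ∀ a, 0 < r a) (hr1 : ∑ a, r a = 1)
    {x : α → ℕ} (hx : ∑ a, x a ≠ 0) : multinomialProb r x ≤ multinomialProb (relFreq x) x := by
  set N : ℝ := ((∑ a, x a : ℕ) : ℝ) with hN
  have hN0 : 0 < N := by rw [hN]; exact_mod_cast Nat.pos_of_ne_zero hx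
  refine mul_le_mul_of_nonneg_left ?_ (Nat.cast_nonneg _)
  have hterm : ∀ a, r a ^ x a ≤ relFreq x a ^ x a * Real.exp (N * r a - x a) := by
    intro a
    rcases Nat.eq_zero_or_pos (x a) with h0 | h0
    · rw [h0]
      simp only [pow_zero, one_mul, Nat.cast_zero, sub_zero, Real.one_le_exp_iff]
      exact mul_nonneg hN0.le (hr a).le
    · have hxa : (0 : ℝ) < x a := by exact_mod_cast h0
      have hf : 0 < relFreq x a := div_pos hxa hN0
      have h1 : r a ≤ relFreq x a * Real.exp (r a / relFreq x a - 1) := by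
        have := Real.add_one_le_exp (r a / relFreq x a - 1)
        rw [sub_add_cancel, div_le_iff₀ hf] at this
        linarith
      calc r a ^ x a ≤ (relFreq x a * Real.exp (r a / relFreq x a - 1)) ^ x a :=
            pow_le_pow_left₀ (hr a).le h1 _
        _ = _ := by
          rw [mul_pow, ← Real.exp_nat_mul]
          congr 2
          simp only [relFreq, ← hN]
          field_simp
  calc ∏ a, r a ^ x a ≤ ∏ a, (relFreq x a ^ x a * Real.exp (N * r a - x a)) :=
        Finset.prod_le_prod (fun a _ => pow_nonneg (hr a).le _) fun a _ => hterm a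
    _ = ∏ a, relFreq x a ^ x a := by
      rw [Finset.prod_mul_distrib, ← Real.exp_sum, Finset.sum_sub_distrib, ← Finset.mul_sum, hr1,
        ← Nat.cast_sum, ← hN, mul_one, sub_self, Real.exp_zero, mul_one]

/-- Points on the segment towards the interior point p are positive and converge to the relative
frequencies. -/
theorem relFreq_mem_closure (hp : ∀ a, 0 < p a) (hp1 : ∑ a, p a = 1) {x : α → ℕ}
    (hx : ∑ a, x a ≠ 0) : relFreq x ∈ closure {q : α → ℝ | (∀ a, 0 < q a) ∧ ∑ a, q a = 1} := by
  have hi : Tendsto (fun n : ℕ => 1 / ((n : ℝ) + 1)) atTop (𝓝 0) :=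
    tendsto_one_div_add_atTop_nhds_zero_nat
  have hlim : Tendsto (fun n : ℕ => relFreq x + (1 / ((n : ℝ) + 1)) • (p - relFreq x)) atTop
      (𝓝 (relFreq x)) := by
    simpa using (hi.smul_const (p - relFreq x)).const_add (relFreq x)
  refine mem_closure_of_tendsto hlim (Eventually.of_forall fun n => ⟨fun a => ?_, ?_⟩)
  · have h1 : 0 < 1 / ((n : ℝ) + 1) := by positivity
    have h2 : 1 / ((n : ℝ) + 1) ≤ 1 := by
      rw [div_le_one (by positivity)]; linarith [(Nat.cast_nonneg n : (0 : ℝ) ≤ n)]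
    simp only [Pi.add_apply, Pi.smul_apply, Pi.sub_apply, smul_eq_mul]
    nlinarith [mul_pos h1 (hp a), mul_nonneg (sub_nonneg.2 h2) (relFreq_nonneg x a)]
  · simp [Finset.sum_add_distrib, ← Finset.mul_sum, sum_relFreq hx, hp1]

variable [DecidableEq α]

/-- One coordinate of a centred indicator takes two values: 1 - p a with probability p a, and -p a
otherwise. -/
theorem sum_mul_single_sub_pow (hp1 : ∑ a, p a = 1) (a : α) (k : ℕ) :
    ∑ b, p b * (LinearMap.proj a : (α → ℝ) →ₗ[ℝ] ℝ) (Pi.single b 1 - p) ^ k =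
      p a * (1 - p a) ^ k + (1 - p a) * (-p a) ^ k := by
  have h : ∀ b, p b * (LinearMap.proj a : (α → ℝ) →ₗ[ℝ] ℝ) (Pi.single b 1 - p) ^ k =
      p b * (-p a) ^ k + if b = a then p b * ((1 - p a) ^ k - (-p a) ^ k) else 0 := by
    intro b
    by_cases hb : b = a
    · subst hb; simp; ring
    · simp [hb, Ne.symm hb]
  simp only [h, Finset.sum_add_distrib, ← Finset.sum_mul, hp1, Finset.sum_ite_eq',
    Finset.mem_univ, if_true]
  ring

/-- With π = p a, the central moments of orders two to four are, to the needed order, π(1-π)/n,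
π(1-π)(1-2π)/n² and 3π²(1-π)²/n². -/
theorem hasExpansion_entropyPoly (hp : ∀ a, 0 < p a) (hp1 : ∑ a, p a = 1) (a : α) :
    HasExpansion (fun n => expect p n fun x => entropyPoly (p a) (deviation p x a))
      ((1 - p a) / 2) (((p a)⁻¹ - p a) / 12) := by
  have h := sum_mul_map_single_sub hp1 (LinearMap.proj a)
  have hpa := (hp a).ne'
  have hdev : ∀ {n : ℕ} {x : α → ℕ}, ∑ b, x b = n → n ≠ 0 → deviation p x a =
      linForm (fun b => (LinearMap.proj a : (α → ℝ) →ₗ[ℝ] ℝ) (Pi.single b 1 - p)) x / n :=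
    fun hx hn => map_deviation (LinearMap.proj a) hx hn
  set u : α → ℝ := fun b => (LinearMap.proj a : (α → ℝ) →ₗ[ℝ] ℝ) (Pi.single b 1 - p) with hu
  have k2 : ∑ b, p b * (u b * u b) = p a * (1 - p a) := by
    simp only [← pow_two, hu, sum_mul_single_sub_pow hp1 a 2]; ring
  have k3 : ∑ b, p b * (u b * u b * u b) = p a * (1 - p a) * (1 - 2 * p a) := by
    simp only [← pow_two, ← pow_succ, hu, sum_mul_single_sub_pow hp1 a 3]; ring
  have hpow : ∀ k n : ℕ, n ≠ 0 → expect p n (fun x => deviation p x a ^ k) =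
      ((n : ℝ) ^ k)⁻¹ * expect p n fun x => linForm u x ^ k := by
    intro k n hn
    rw [← expect_const_mul]
    refine expect_congr fun x hx => ?_
    rw [hdev hx hn, div_pow, div_eq_inv_mul]
  have e1 : HasExpansion (fun n => expect p n fun x => deviation p x a) 0 0 := by
    refine hasExpansion_zero.congr ?_
    filter_upwards [eventually_ne_atTop 0] with n hn
    have := hpow 1 n hn
    simp only [pow_one] at this
    rw [this, expect_linForm hp1 h, mul_zero]
  have e2 : HasExpansion (fun n => expect p n fun x => deviation p x a ^ 2)
      (p a * (1 - p a)) 0 := by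
    refine hasExpansion_div_add_div.congr ?_
    filter_upwards [eventually_ne_atTop 0] with n hn
    have hn' : (n : ℝ) ≠ 0 := by exact_mod_cast hn
    rw [hpow 2 n hn]
    simp only [pow_two (linForm u _)]
    rw [expect_linForm_mul_linForm hp1 h h, k2]
    field_simp
    ring
  have e3 : HasExpansion (fun n => expect p n fun x => deviation p x a ^ 3) 0
      (p a * (1 - p a) * (1 - 2 * p a)) := by
    refine hasExpansion_div_add_div.congr ?_
    filter_upwards [eventually_ne_atTop 0] with n hn
    have hn' : (n : ℝ) ≠ 0 := by exact_mod_cast hn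
    have := expect_linForm_mul₃ (n := n) hp1 h h h
    rw [k3] at this
    simp only [← pow_two, ← pow_succ] at this
    rw [hpow 3 n hn, this]
    field_simp
    ring
  have e4 : HasExpansion (fun n => expect p n fun x => deviation p x a ^ 4) 0
      (3 * (p a * (1 - p a)) ^ 2) := by
    obtain ⟨A, hA⟩ : ∃ A : ℝ, ∀ n : ℕ, expect p n (fun x => linForm u x ^ 4) =
        n * A + n * (n - 1) * (3 * (p a * (1 - p a)) ^ 2) := by
      refine ⟨∑ b, p b * (u b * u b * u b * u b), fun n => ?_⟩
      have e : (fun x => linForm u x ^ 4) =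
          fun x => linForm u x * linForm u x * linForm u x * linForm u x := by
        ext x; ring
      rw [e, expect_linForm_mul₄ hp1 h h h h, k2]
      ring
    have hi : Tendsto (fun n : ℕ => ((n : ℝ))⁻¹) atTop (𝓝 0) := tendsto_inv_atTop_nhds_zero_nat
    have hlim := (hi.mul_const A).add ((hi.const_sub 1).mul_const (3 * (p a * (1 - p a)) ^ 2))
    rw [zero_mul, zero_add, sub_zero, one_mul] at hlim
    refine hasExpansion_of_tendsto (hlim.congr' ?_)
    filter_upwards [eventually_ne_atTop 0] with n hn
    have hn' : (n : ℝ) ≠ 0 := by exact_mod_cast hn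
    rw [hpow 4 n hn, hA]
    field_simp
  have hall := ((e1.add (e2.const_mul (2 * p a)⁻¹)).sub (e3.const_mul (6 * p a ^ 2)⁻¹)).add
    (e4.const_mul (12 * p a ^ 3)⁻¹)
  have c1 : 0 + (2 * p a)⁻¹ * (p a * (1 - p a)) - (6 * p a ^ 2)⁻¹ * 0 + (12 * p a ^ 3)⁻¹ * 0 =
      (1 - p a) / 2 := by field_simp; ring
  have c2 : 0 + (2 * p a)⁻¹ * 0 - (6 * p a ^ 2)⁻¹ * (p a * (1 - p a) * (1 - 2 * p a)) +
      (12 * p a ^ 3)⁻¹ * (3 * (p a * (1 - p a)) ^ 2) = ((p a)⁻¹ - p a) / 12 := by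
    field_simp; ring
  rw [c1, c2] at hall
  refine hall.congr (Eventually.of_forall fun n => ?_)
  simp only [entropyPoly, expect_add, expect_sub, expect_const_mul]

/-- The risk of the relative frequencies. -/
theorem hasExpansion_klDivergence_relFreq (hp : ∀ a, 0 < p a) (hp1 : ∑ a, p a = 1) :
    HasExpansion (fun n => expect p n fun x => klDivergence (relFreq x) p)
      (((Fintype.card α : ℝ) - 1) / 2) ((∑ a, (p a)⁻¹ - 1) / 12) := by
  have hp0 : ∀ a, 0 ≤ p a := fun a => (hp a).le
  choose C hC using fun a => exists_abs_sub_entropyPoly_le (hp a)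
  have hpoly := HasExpansion.sum (s := univ) fun a _ => hasExpansion_entropyPoly hp hp1 a
  have herr := HasExpansion.sum (s := univ) fun a _ =>
    (hasExpansion_abs_deviation_pow_five hp0 hp1 a).const_mul (C a)
  simp only [mul_zero, Finset.sum_const_zero] at herr
  have c1 : ∑ a, (1 - p a) / 2 = ((Fintype.card α : ℝ) - 1) / 2 := by
    rw [← Finset.sum_div, Finset.sum_sub_distrib, hp1]; simp
  have c2 : ∑ a, ((p a)⁻¹ - p a) / 12 = (∑ a, (p a)⁻¹ - 1) / 12 := by
    rw [← Finset.sum_div, Finset.sum_sub_distrib, hp1]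
  rw [c1, c2] at hpoly
  have hlo := hpoly.sub herr
  have hhi := hpoly.add herr
  rw [sub_zero, sub_zero] at hlo
  rw [add_zero, add_zero] at hhi
  have hKL : ∀ x : α → ℕ, klDivergence (relFreq x) p =
      ∑ a, (p a + deviation p x a) * Real.log ((p a + deviation p x a) / p a) := by
    intro x
    refine Finset.sum_congr rfl fun a _ => ?_
    rw [deviation_eq, Pi.sub_apply, add_sub_cancel]
  have hb : ∀ (x : α → ℕ) a, |(p a + deviation p x a) *
      Real.log ((p a + deviation p x a) / p a) - entropyPoly (p a) (deviation p x a)| ≤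
      C a * |deviation p x a| ^ 5 :=
    fun x a => hC a _ ((norm_le_pi_norm _ a).trans (norm_deviation_le_one hp0 hp1 x))
  refine hlo.squeeze hhi (Eventually.of_forall fun n => ?_) (Eventually.of_forall fun n => ?_)
  · simp only [← expect_const_mul, ← expect_sum]
    rw [← expect_sub]
    refine expect_mono hp0 fun x _ => ?_
    rw [hKL, ← Finset.sum_sub_distrib]
    exact Finset.sum_le_sum fun a _ => by linarith [(abs_le.1 (hb x a)).1]
  · simp only [← expect_const_mul, ← expect_sum]
    rw [← expect_add]
    refine expect_mono hp0 fun x _ => ?_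
    rw [hKL, ← Finset.sum_add_distrib]
    exact Finset.sum_le_sum fun a _ => by linarith [(abs_le.1 (hb x a)).2]

end FullModel

/-! ### Conditioning on an event of almost full probability -/

section Ratio

variable {R D : ℕ → ℝ} {a b : ℝ}

theorem HasExpansion.tendsto_zero (h : HasExpansion R a b) : Tendsto R atTop (𝓝 0) := by
  have hi : Tendsto (fun n : ℕ => ((n : ℝ))⁻¹) atTop (𝓝 0) := tendsto_inv_atTop_nhds_zero_nat
  have := hi.mul h.tendsto_mul
  rw [zero_mul] at this
  refine this.congr' ?_
  filter_upwards [eventually_ne_atTop 0] with n hn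
  have hn' : (n : ℝ) ≠ 0 := by exact_mod_cast hn
  field_simp

/-- R/D - R = R(1 - D)/D, where n²(1 - D) → 0, R → 0 and D → 1. Sizes with D = 0 are finitely many.
-/
theorem HasExpansion.div (h : HasExpansion R a b) (hD : HasExpansion (fun n => 1 - D n) 0 0) :
    HasExpansion (fun n => R n / D n) a b := by
  have hD1 : Tendsto D atTop (𝓝 1) := by
    simpa using hD.tendsto_zero.const_sub 1
  have h1 := (h.tendsto_zero.mul hD.tendsto_sq_mul).div hD1 one_ne_zero
  rw [hasExpansion_iff_tendsto] at h ⊢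
  have h2 := h.add h1
  rw [zero_mul, zero_div, add_zero] at h2
  refine h2.congr' ?_
  filter_upwards [hD1.eventually_ne one_ne_zero] with n hn
  simp only [Pi.div_apply]
  field_simp
  ring

end Ratio

/-! ### Decomposition of the two-stage model into groups -/

section TwoStageModel

variable {I : ℕ} {J s : Fin I → ℕ} {c : Fin I → ℝ} {M : (i : Fin I) → ParametricModel (J i) (s i)}
  {p : (i : Fin I) → Fin (J i) → ℝ}

/-- The probabilities of the cells of the `i`-th group, given that group. -/
def groupProb (c : Fin I → ℝ) (q : Cell J → ℝ) (i : Fin I) : Fin (J i) → ℝ := fun j => q ⟨i, j⟩ / c i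

theorem cellProb_pos (hc : ∀ i, 0 < c i) (hp : ∀ i j, 0 < p i j) (a : Cell J) :
    0 < cellProb c p a := mul_pos (hc _) (hp _ _)

theorem sum_cellProb (hc1 : ∑ i, c i = 1) (hp1 : ∀ i, ∑ j, p i j = 1) :
    ∑ a, cellProb c p a = 1 := by
  rw [Fintype.sum_sigma]
  simp only [cellProb, ← Finset.mul_sum, hp1, mul_one, hc1]

theorem mem_twoStageModel (hc : ∀ i, 0 < c i) (hc1 : ∑ i, c i = 1) {r : Cell J → ℝ}
    (hr : r ∈ twoStageModel c M) : (∀ a, 0 < r a) ∧ ∑ a, r a = 1 := by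
  obtain ⟨θ, hθ, rfl⟩ := hr
  exact ⟨cellProb_pos hc fun i => (M i).prob_pos _ (hθ i),
    sum_cellProb hc1 fun i => (M i).prob_sum _ (hθ i)⟩

theorem groupProb_cellProb (hc : ∀ i, 0 < c i) (i : Fin I) :
    groupProb c (cellProb c p) i = p i := by
  ext j
  have := (hc i).ne'
  simp only [groupProb, cellProb]
  field_simp

/-- Each ratio q/(c p) is (q/c)/p. Dividing by the known c i, not by the group total of q, leaves no
first-stage term and needs no condition on q. -/
theorem klDivergence_cellProb (hc : ∀ i, 0 < c i) (q : Cell J → ℝ) :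
    klDivergence q (cellProb c p) = ∑ i, c i * klDivergence (groupProb c q i) (p i) := by
  rw [klDivergence, Fintype.sum_sigma]
  refine Finset.sum_congr rfl fun i _ => ?_
  rw [klDivergence, Finset.mul_sum]
  refine Finset.sum_congr rfl fun j _ => ?_
  have := (hc i).ne'
  simp only [groupProb, cellProb, div_div]
  field_simp

/-- Replace the probabilities of the cells of the `i`-th group by `c i * r j`. -/
def replaceGroup (c : Fin I → ℝ) (i : Fin I) (r : Fin (J i) → ℝ) (q : Cell J → ℝ) : Cell J → ℝ :=
  fun a => Function.update (fun i j => q ⟨i, j⟩) i (fun j => c i * r j) a.1 a.2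

theorem replaceGroup_self (i : Fin I) (r : Fin (J i) → ℝ) (q : Cell J → ℝ) (j : Fin (J i)) :
    replaceGroup c i r q ⟨i, j⟩ = c i * r j := by simp [replaceGroup]

theorem replaceGroup_of_ne {i i' : Fin I} (h : i' ≠ i) (r : Fin (J i) → ℝ) (q : Cell J → ℝ)
    (j : Fin (J i')) : replaceGroup c i r q ⟨i', j⟩ = q ⟨i', j⟩ := by simp [replaceGroup, h]

theorem continuous_replaceGroup (i : Fin I) (r : Fin (J i) → ℝ) :
    Continuous (replaceGroup c i r) := by
  refine continuous_pi fun ⟨i', j⟩ => ?_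
  by_cases h : i' = i
  · subst h
    simp only [replaceGroup_self]
    exact continuous_const
  · simp only [replaceGroup_of_ne h]
    exact continuous_apply _

/-- The parameters of the groups vary independently; this is what permits group-by-group
maximization. -/
theorem replaceGroup_mem {i : Fin I} {r : Fin (J i) → ℝ} (hr : r ∈ (M i).carrier)
    {q : Cell J → ℝ} (hq : q ∈ twoStageModel c M) : replaceGroup c i r q ∈ twoStageModel c M := by
  obtain ⟨θ, hθ, rfl⟩ := hq
  obtain ⟨θ', hθ', rfl⟩ := hr
  refine ⟨Function.update θ i θ', fun i' => ?_, ?_⟩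
  · by_cases h : i' = i
    · subst h; simpa using hθ'
    · simpa [h] using hθ i'
  · ext ⟨i', j⟩
    by_cases h : i' = i
    · subst h; simp [replaceGroup_self, cellProb]
    · simp [replaceGroup_of_ne h, cellProb, h]

theorem continuous_multinomialProb {α : Type*} [Fintype α] (x : α → ℕ) :
    Continuous fun q : α → ℝ => multinomialProb q x := by
  unfold multinomialProb
  fun_prop

theorem IsMaxLik.le_of_mem_closure {α : Type*} [Fintype α] {M : Set (α → ℝ)} {x : α → ℕ}
    {q r : α → ℝ} (h : IsMaxLik M x q) (hr : r ∈ closure M) :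
    multinomialProb r x ≤ multinomialProb q x := by
  have hc : IsClosed {r : α → ℝ | multinomialProb r x ≤ multinomialProb q x} :=
    isClosed_le (continuous_multinomialProb x) continuous_const
  have hsub : M ⊆ {r : α → ℝ | multinomialProb r x ≤ multinomialProb q x} := h.2
  exact closure_minimal hsub hc hr

/-- Maximum likelihood estimation in a two-stage model is carried out group by group. -/
theorem IsMaxLik.group (hc : ∀ i, 0 < c i) (hc1 : ∑ i, c i = 1) {m : Cell J → ℝ}
    (hm : m ∈ twoStageModel c M) {x : Cell J → ℕ} {q : Cell J → ℝ}
    (h : IsMaxLik (twoStageModel c M) x q) (i : Fin I) :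
    IsMaxLik (M i).carrier (groupCounts i x) (groupProb c q i) := by
  have hsimp := closure_subset_simplex (fun r => mem_twoStageModel hc hc1) h.1
  refine ⟨?_, fun r hr => ?_⟩
  · have hcont : Continuous fun q : Cell J → ℝ => groupProb c q i :=
      continuous_pi fun j => (continuous_apply _).div_const _
    refine map_mem_closure hcont h.1 fun q hq => ?_
    obtain ⟨θ, hθ, rfl⟩ := hq
    beta_reduce
    rw [groupProb_cellProb hc]
    exact ⟨θ i, hθ i, rfl⟩
  · have h1 : replaceGroup c i r q ∈ closure (twoStageModel c M) :=
      map_mem_closure (continuous_replaceGroup i r) h.1 fun q hq => replaceGroup_mem hr hq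
    have h2 := h.le_of_mem_closure h1
    -- The estimate may lie on the boundary, but its likelihood is at least that of m and so
    -- positive. The factor of the other groups is therefore positive and can be cancelled.
    have h3 : 0 < multinomialProb q x :=
      (multinomialProb_pos (mem_twoStageModel hc hc1 hm).1 x).trans_le (h.2 m hm)
    have hmult : (0 : ℝ) < Nat.multinomial univ x := by exact_mod_cast Nat.multinomial_pos _ _
    have hsplit : ∀ q : Cell J → ℝ, ∏ a, q a ^ x a = (∏ j, q ⟨i, j⟩ ^ x ⟨i, j⟩) *
        ∏ i' ∈ univ.erase i, ∏ j, q ⟨i', j⟩ ^ x ⟨i', j⟩ := fun q => by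
      rw [Fintype.prod_sigma]
      exact (Finset.mul_prod_erase univ (fun i' => ∏ j, q ⟨i', j⟩ ^ x ⟨i', j⟩) (mem_univ i)).symm
    have hrest : ∏ i' ∈ univ.erase i, ∏ j, replaceGroup c i r q ⟨i', j⟩ ^ x ⟨i', j⟩ =
        ∏ i' ∈ univ.erase i, ∏ j, q ⟨i', j⟩ ^ x ⟨i', j⟩ :=
      Finset.prod_congr rfl fun i' hi' => Finset.prod_congr rfl fun j _ => by
        rw [replaceGroup_of_ne (Finset.ne_of_mem_erase hi')]
    rw [multinomialProb, multinomialProb, hsplit, hsplit, hrest] at h2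
    rw [multinomialProb, hsplit] at h3
    have h4 := pos_of_mul_pos_right h3 hmult.le
    have hE : 0 ≤ ∏ i' ∈ univ.erase i, ∏ j, q ⟨i', j⟩ ^ x ⟨i', j⟩ :=
      Finset.prod_nonneg fun i' _ => Finset.prod_nonneg fun j _ => pow_nonneg (hsimp.1 _) _
    have hE' : 0 < ∏ i' ∈ univ.erase i, ∏ j, q ⟨i', j⟩ ^ x ⟨i', j⟩ :=
      lt_of_le_of_ne hE fun e => by rw [← e, mul_zero] at h4; exact lt_irrefl _ h4
    have h5 := le_of_mul_le_mul_right (le_of_mul_le_mul_left h2 hmult) hE'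
    simp only [replaceGroup_self, mul_pow, Finset.prod_mul_distrib] at h5
    refine mul_le_mul_of_nonneg_left ?_ (Nat.cast_nonneg _)
    have hC : 0 < ∏ j, c i ^ x ⟨i, j⟩ := Finset.prod_pos fun j _ => pow_pos (hc i) _
    refine le_of_mul_le_mul_left (h5.trans (le_of_eq ?_)) hC
    rw [← Finset.prod_mul_distrib]
    refine Finset.prod_congr rfl fun j _ => ?_
    rw [groupCounts, ← mul_pow, groupProb, mul_div_cancel₀ _ (hc i).ne']

/-- The number of empty groups. -/
def numEmpty (x : Cell J → ℕ) : ℝ := ∑ i, if ∑ j, groupCounts i x j = 0 then 1 else 0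

theorem numEmpty_nonneg (x : Cell J → ℕ) : 0 ≤ numEmpty x :=
  Finset.sum_nonneg fun i _ => by split_ifs <;> norm_num

theorem one_le_numEmpty {x : Cell J → ℕ} (hx : x ∉ noEmptyGroup J) : 1 ≤ numEmpty x := by
  have : ∃ i, ∑ j, groupCounts i x j = 0 := by
    by_contra! hne
    exact hx hne
  obtain ⟨i, hi⟩ := this
  have := Finset.single_le_sum (f := fun i => if ∑ j, groupCounts i x j = 0 then (1 : ℝ) else 0)
    (fun i _ => by split_ifs <;> norm_num) (mem_univ i)
  beta_reduce at this
  rw [if_pos hi] at this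
  exact this

theorem le_one_of_sum_eq_one (hc : ∀ i, 0 < c i) (hc1 : ∑ i, c i = 1) (i : Fin I) : c i ≤ 1 := by
  rw [← hc1]; exact Finset.single_le_sum (fun i _ => (hc i).le) (mem_univ i)

/-- The expectation is the exponentially small sum of the (1 - c i)^n. It bounds the probability of
the excluded samples without computing that probability. -/
theorem hasExpansion_numEmpty (hc : ∀ i, 0 < c i) (hc1 : ∑ i, c i = 1)
    (hp1 : ∀ i, ∑ j, p i j = 1) : HasExpansion (fun n => expect (cellProb c p) n numEmpty) 0 0 := by
  have h := HasExpansion.sum (s := univ) fun i _ => hasExpansion_mul_pow (hc i)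
    (le_one_of_sum_eq_one hc hc1 i) (f := fun _ => 1) (K := 1) (by simp)
  simp only [Finset.sum_const_zero] at h
  refine h.congr (Eventually.of_forall fun n => ?_)
  have e : ∀ i, expect (cellProb c p) n
      (fun x => if ∑ j, groupCounts i x j = 0 then 1 else 0) = (1 - c i) ^ n := by
    intro i
    rw [expect_groupCounts hc1 hp1 i n fun y => if ∑ j, y j = 0 then 1 else 0,
      ← binomialExpect_indicator_zero]
    congr 1
    ext k
    rw [expect_congr (g := fun _ => if k = 0 then 1 else 0) fun x hx => by rw [hx],
      expect_const (hp1 i)]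
  unfold numEmpty
  rw [expect_sum]
  simp only [e, one_mul]

/-- The weight c i cancels one power of c i in the transfer to a binomial group size. -/
theorem hasExpansion_groupCounts (hc : ∀ i, 0 < c i) (hc1 : ∑ i, c i = 1)
    (hp1 : ∀ i, ∑ j, p i j = 1) {F : (i : Fin I) → (Fin (J i) → ℕ) → ℝ} {a b : Fin I → ℝ}
    (hF : ∀ i, HasExpansion (fun n => expect (p i) n (F i)) (a i) (b i)) :
    HasExpansion (fun n => expect (cellProb c p) n fun x => ∑ i, c i * F i (groupCounts i x))
      (∑ i, a i) (∑ i, (c i)⁻¹ * (a i * (1 - c i) + b i)) := by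
  have h := HasExpansion.sum (s := univ) fun i _ =>
    ((hF i).binomialExpect (hc i) (le_one_of_sum_eq_one hc hc1 i)).const_mul (c i)
  have e1 : ∀ i, c i * (a i / c i) = a i := fun i => mul_div_cancel₀ _ (hc i).ne'
  have e2 : ∀ i, c i * ((a i * (1 - c i) + b i) / c i ^ 2) =
      (c i)⁻¹ * (a i * (1 - c i) + b i) := fun i => by
    have := (hc i).ne'
    field_simp
  simp only [e1, e2] at h
  refine h.congr (Eventually.of_forall fun n => ?_)
  simp only [expect_sum, expect_const_mul, expect_groupCounts hc1 hp1]

/-- A conditional risk that is squeezed between two bounded functions of the group counts. -/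
theorem hasExpansion_condExpect (hc : ∀ i, 0 < c i) (hc1 : ∑ i, c i = 1)
    (hp0 : ∀ i j, 0 < p i j) (hp1 : ∀ i, ∑ j, p i j = 1)
    {lo hi : (i : Fin I) → (Fin (J i) → ℕ) → ℝ} {a b K : Fin I → ℝ}
    (hlo : ∀ i, HasExpansion (fun n => expect (p i) n (lo i)) (a i) (b i))
    (hhi : ∀ i, HasExpansion (fun n => expect (p i) n (hi i)) (a i) (b i))
    (hloK : ∀ i y, |lo i y| ≤ K i) (hhiK : ∀ i y, |hi i y| ≤ K i) {f : (Cell J → ℕ) → ℝ}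
    (hf : ∀ x ∈ noEmptyGroup J, ∑ i, c i * lo i (groupCounts i x) ≤ f x ∧
      f x ≤ ∑ i, c i * hi i (groupCounts i x)) :
    HasExpansion (fun n => condExpect (cellProb c p) n (noEmptyGroup J) f)
      (∑ i, a i) (∑ i, (c i)⁻¹ * (a i * (1 - c i) + b i)) := by
  classical
  have hm0 : ∀ a, 0 ≤ cellProb c p a := fun a => (cellProb_pos hc hp0 a).le
  have hm1 := sum_cellProb hc1 hp1
  have hE := hasExpansion_numEmpty (J := J) hc hc1 hp1
  set B := ∑ i, c i * K i with hB
  have hbound : ∀ F : (i : Fin I) → (Fin (J i) → ℕ) → ℝ, (∀ i y, |F i y| ≤ K i) → ∀ x,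
      |∑ i, c i * F i (groupCounts i x)| ≤ B := by
    intro F hF x
    refine (Finset.abs_sum_le_sum_abs _ _).trans (Finset.sum_le_sum fun i _ => ?_)
    rw [abs_mul, abs_of_pos (hc i)]
    exact mul_le_mul_of_nonneg_left (hF i _) (hc i).le
  have hB0 : 0 ≤ B := (abs_nonneg _).trans (hbound lo hloK 0)
  -- On samples with an empty group the indicator is 0 while the envelopes may reach B in absolute
  -- value; shifting them by `B * numEmpty` restores the inequalities there.
  have hEB := hE.const_mul B
  have h1 := (hasExpansion_groupCounts hc hc1 hp1 hlo).sub hEB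
  have h2 := (hasExpansion_groupCounts hc hc1 hp1 hhi).add hEB
  simp only [mul_zero, sub_zero] at h1
  simp only [mul_zero, add_zero] at h2
  have hnum : HasExpansion (fun n => expect (cellProb c p) n ((noEmptyGroup J).indicator f))
      (∑ i, a i) (∑ i, (c i)⁻¹ * (a i * (1 - c i) + b i)) := by
    refine h1.squeeze h2 (Eventually.of_forall fun n => ?_) (Eventually.of_forall fun n => ?_)
    · rw [← expect_const_mul, ← expect_sub]
      refine expect_mono hm0 fun x _ => ?_
      by_cases hx : x ∈ noEmptyGroup J
      · rw [Set.indicator_of_mem hx]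
        linarith [(hf x hx).1, mul_nonneg hB0 (numEmpty_nonneg x)]
      · rw [Set.indicator_of_notMem hx]
        linarith [(abs_le.1 (hbound lo hloK x)).2, mul_le_mul_of_nonneg_left (one_le_numEmpty hx) hB0]
    · rw [← expect_const_mul, ← expect_add]
      refine expect_mono hm0 fun x _ => ?_
      by_cases hx : x ∈ noEmptyGroup J
      · rw [Set.indicator_of_mem hx]
        linarith [(hf x hx).2, mul_nonneg hB0 (numEmpty_nonneg x)]
      · rw [Set.indicator_of_notMem hx]
        linarith [(abs_le.1 (hbound hi hhiK x)).1, mul_le_mul_of_nonneg_left (one_le_numEmpty hx) hB0]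
  -- The probability of the excluded samples lies between 0 and the expected number of empty groups.
  refine hnum.div (hasExpansion_zero.squeeze hE (Eventually.of_forall fun n => ?_)
    (Eventually.of_forall fun n => ?_))
  · rw [sub_nonneg]
    calc _ ≤ expect (cellProb c p) n fun _ => 1 := expect_mono hm0 fun x _ =>
          Set.indicator_le_self' (fun _ _ => zero_le_one) x
      _ = 1 := expect_one hm1
  · rw [sub_le_iff_le_add, ← expect_add]
    refine (expect_one (n := n) hm1).symm.le.trans (expect_mono hm0 fun x _ => ?_)
    by_cases hx : x ∈ noEmptyGroup J
    · rw [Set.indicator_of_mem hx]; linarith [numEmpty_nonneg x]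
    · rw [Set.indicator_of_notMem hx]; linarith [one_le_numEmpty hx]

theorem twoStageModel_eq_aggregationSubmodel (hc : ∀ i, 0 < c i) (hM : ∀ i, (M i).IsFull) :
    twoStageModel c M = aggregationSubmodel J c := by
  ext m
  constructor
  · rintro ⟨θ, hθ, rfl⟩
    refine ⟨cellProb_pos hc fun i => (M i).prob_pos _ (hθ i), fun i => ?_⟩
    simp only [cellProb, ← Finset.mul_sum, (M i).prob_sum _ (hθ i), mul_one]
  · rintro ⟨h0, h1⟩
    have hmem : ∀ i, groupProb c m i ∈ (M i).carrier := by
      intro i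
      rw [hM i]
      refine ⟨fun j => div_pos (h0 _) (hc i), ?_⟩
      simp only [groupProb, ← Finset.sum_div, h1]
      exact div_self (hc i).ne'
    choose θ hθ hθ' using hmem
    refine ⟨θ, hθ, ?_⟩
    ext ⟨i, j⟩
    simp only [cellProb, hθ', groupProb]
    exact (mul_div_cancel₀ _ (hc i).ne').symm

end TwoStageModel

/-- In a full model, the dimension and the second-order term of the risk are determined by the
relative frequencies. -/
theorem ParametricModel.IsFull.coefficients {J s : ℕ} {M : ParametricModel J s} (hM : M.IsFull)
    {p : Fin J → ℝ} (hp : p ∈ M.carrier) {A : ℝ}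
    (hA : ∀ phat : (Fin J → ℕ) → Fin J → ℝ, IsMLE M.carrier {x | ∑ j, x j ≠ 0} phat →
      HasExpansion (fun n => expect p n fun x => klDivergence (phat x) p) ((s : ℝ) / 2) (A / 24)) :
    (s : ℝ) = J - 1 ∧ A = 2 * (∑ j, (p j)⁻¹ - 1) := by
  obtain ⟨hp0, hp1⟩ := M.mem_carrier hp
  have hmle : IsMLE M.carrier {x | ∑ j, x j ≠ 0} relFreq := by
    intro x hx
    refine ⟨?_, fun q hq => ?_⟩
    · rw [hM]
      exact relFreq_mem_closure hp0 hp1 hx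
    · obtain ⟨hq0, hq1⟩ := M.mem_carrier hq
      exact multinomialProb_le_relFreq hq0 hq1 hx
  have h1 := hA _ hmle
  have h2 := hasExpansion_klDivergence_relFreq hp0 hp1
  rw [Fintype.card_fin] at h2
  have e1 := h1.unique_fst h2
  have e2 := h1.unique_snd h2
  constructor <;> linarith

end TwoStage
end

/-! ### Assembly of the theorem -/

theorem theorem3 {I : ℕ} {J s : Fin I → ℕ}
    (c : Fin I → ℝ) (hc : ∀ i, 0 < c i) (hc1 : ∑ i, c i = 1)
    (M : (i : Fin I) → TwoStage.ParametricModel (J i) (s i))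
    (θ : (i : Fin I) → Fin (s i) → ℝ) (hθ : ∀ i, θ i ∈ (M i).Θ)
    (p : (i : Fin I) → Fin (J i) → ℝ) (hp : ∀ i, p i = (M i).prob (θ i))
    (m : TwoStage.Cell J → ℝ) (hm : m = TwoStage.cellProb c p)
    (p' : ℝ) (hp' : p' = (I : ℝ) - 1 + ∑ i, (s i : ℝ)) :
    ∃ A : Fin I → ℝ,
      -- `A i / (24 n²)` is the second-order term of the risk in the `i`-th second-stage model
      (∀ i, ∀ phat : (Fin (J i) → ℕ) → Fin (J i) → ℝ,
        TwoStage.IsMLE (M i).carrier {x | ∑ j, x j ≠ 0} phat →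
        TwoStage.HasExpansion
          (fun n => TwoStage.expect (p i) n fun x => TwoStage.klDivergence (phat x) (p i))
          ((s i : ℝ) / 2) (A i / 24)) ∧
      -- the risk in the two-stage model with known first stage
      (∀ mhat : (TwoStage.Cell J → ℕ) → TwoStage.Cell J → ℝ,
        TwoStage.IsMLE (TwoStage.twoStageModel c M) (TwoStage.noEmptyGroup J) mhat →
        TwoStage.HasExpansion
          (fun n => TwoStage.condExpect m n (TwoStage.noEmptyGroup J)
            fun x => TwoStage.klDivergence (mhat x) m)
          ((∑ i, (s i : ℝ)) / 2)
          ((1 / 24) * ∑ i, (c i)⁻¹ * (A i + 12 * (1 - c i) * s i))) ∧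
      -- the case in which every second-stage model is full
      ((∀ i, (M i).IsFull) →
        TwoStage.twoStageModel c M = TwoStage.aggregationSubmodel J c ∧
        ∀ mhat : (TwoStage.Cell J → ℕ) → TwoStage.Cell J → ℝ,
          TwoStage.IsMLE (TwoStage.aggregationSubmodel J c) (TwoStage.noEmptyGroup J) mhat →
          TwoStage.HasExpansion
            (fun n => TwoStage.condExpect m n (TwoStage.noEmptyGroup J)
              fun x => TwoStage.klDivergence (mhat x) m)
            ((p' - ((I : ℝ) - 1)) / 2)
            ((1 / 12) * (∑ i, ∑ j, (m ⟨i, j⟩)⁻¹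
              + ∑ i, (c i)⁻¹ * (6 * (J i : ℝ) - 7) - 6 * (p' + 1 - I)))) := by
  obtain rfl : p = fun i => (M i).prob (θ i) := funext hp
  subst hm
  have hp0 : ∀ i j, 0 < (M i).prob (θ i) j := fun i => (M i).prob_pos _ (hθ i)
  have hp1 : ∀ i, ∑ j, (M i).prob (θ i) j = 1 := fun i => (M i).prob_sum _ (hθ i)
  -- The constants A are fixed here, before any estimator is introduced.
  choose A K lo hi hloK hhiK hbd hlo hhi using fun i =>
    TwoStage.ParametricModel.exists_envelope (hθ i)
  have part1 : ∀ i, ∀ phat : (Fin (J i) → ℕ) → Fin (J i) → ℝ,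
      TwoStage.IsMLE (M i).carrier {x | ∑ j, x j ≠ 0} phat →
      TwoStage.HasExpansion (fun n => TwoStage.expect ((M i).prob (θ i)) n
        fun x => TwoStage.klDivergence (phat x) ((M i).prob (θ i)))
        ((s i : ℝ) / 2) (A i / 24) := by
    intro i phat hphat
    have hpn : ∀ j, 0 ≤ (M i).prob (θ i) j := fun j => (hp0 i j).le
    refine (hlo i).squeeze (hhi i) ?_ ?_
    -- At n = 0 the only sample is empty and the estimator is unconstrained.
    · filter_upwards [eventually_ne_atTop 0] with n hn
      refine TwoStage.expect_mono hpn fun x hx => ?_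
      have hx0 : ∑ j, x j ≠ 0 := by rwa [hx]
      exact (hbd i x _ hx0 (hphat x hx0)).1
    · filter_upwards [eventually_ne_atTop 0] with n hn
      refine TwoStage.expect_mono hpn fun x hx => ?_
      have hx0 : ∑ j, x j ≠ 0 := by rwa [hx]
      exact (hbd i x _ hx0 (hphat x hx0)).2
  have part2 : ∀ mhat : (TwoStage.Cell J → ℕ) → TwoStage.Cell J → ℝ,
      TwoStage.IsMLE (TwoStage.twoStageModel c M) (TwoStage.noEmptyGroup J) mhat →
      TwoStage.HasExpansion
        (fun n => TwoStage.condExpect (TwoStage.cellProb c fun i => (M i).prob (θ i)) n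
          (TwoStage.noEmptyGroup J) fun x =>
            TwoStage.klDivergence (mhat x) (TwoStage.cellProb c fun i => (M i).prob (θ i)))
        ((∑ i, (s i : ℝ)) / 2)
        ((1 / 24) * ∑ i, (c i)⁻¹ * (A i + 12 * (1 - c i) * s i)) := by
    intro mhat hmhat
    have h := TwoStage.hasExpansion_condExpect hc hc1 hp0 hp1 hlo hhi hloK hhiK
      (f := fun x => TwoStage.klDivergence (mhat x) (TwoStage.cellProb c fun i => (M i).prob (θ i)))
      fun x hx => by
        have hg := fun i => hbd i _ _ (hx i) (TwoStage.IsMaxLik.group hc hc1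
          (m := TwoStage.cellProb c fun i => (M i).prob (θ i)) ⟨θ, hθ, rfl⟩ (hmhat x hx) i)
        rw [TwoStage.klDivergence_cellProb hc]
        exact ⟨Finset.sum_le_sum fun i _ => mul_le_mul_of_nonneg_left (hg i).1 (hc i).le,
          Finset.sum_le_sum fun i _ => mul_le_mul_of_nonneg_left (hg i).2 (hc i).le⟩
    convert h using 1
    · rw [Finset.sum_div]
    · rw [Finset.mul_sum]
      exact Finset.sum_congr rfl fun i _ => by ring
  refine ⟨A, part1, part2, fun hfull => ?_⟩
  have heq := TwoStage.twoStageModel_eq_aggregationSubmodel hc hfull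
  refine ⟨heq, fun mhat hmhat => ?_⟩
  have h := part2 mhat (heq ▸ hmhat)
  -- With s = J - 1 and A = 2(∑ 1/p - 1), the constant -7 in 6J - 7 arises as -1 from A and -6 from
  -- 6(J - 1), and ∑ 1/p divided by c i is ∑ 1/m over the group.
  have hcoef := fun i => (hfull i).coefficients ⟨θ i, hθ i, rfl⟩ (part1 i)
  convert h using 1
  · rw [hp']; ring
  · have e : p' + 1 - I = ∑ i, (s i : ℝ) := by rw [hp']; ring
    rw [e, Finset.mul_sum univ _ 6, ← Finset.sum_add_distrib, ← Finset.sum_sub_distrib,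
      Finset.mul_sum, Finset.mul_sum]
    refine Finset.sum_congr rfl fun i _ => ?_
    obtain ⟨e1, e2⟩ := hcoef i
    have e3 : ∑ j, (TwoStage.cellProb c (fun i => (M i).prob (θ i)) ⟨i, j⟩)⁻¹ =
        (c i)⁻¹ * ∑ j, ((M i).prob (θ i) j)⁻¹ := by
      simp only [TwoStage.cellProb, mul_inv, Finset.mul_sum]
    rw [e1, e2, e3]
    have := (hc i).ne'
    field_simp
    ring
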